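/- **Setting.** Let $n\ge 2$. A linear order $\sigma$ on $[n]=\{1,\dots,n\}$ is written as a word $x_1x_2\dots x_n$, meaning $x_1<_\sigma x_2<_\sigma\dots<_\sigma x_n$; let $\alpha=12\dots n$ and $\omega=n(n-1)\dots1$. An inversion of $\sigma$ is a pair $(i,j)$ with $i<j$ and $j<_\sigma i$. In the Bruhat graph, whose vertices are the linear orders on $[n]$, two orders are adjacent iff the inversion set of one of them is that of the other plus exactly one pair. A domain is a set $\mathcal D$ of linear orders on $[n]$. * $\mathcal D$ is a *Condorcet domain* if there are no $i,j,k\in[n]$ and three members of $\mathcal D$ whose restrictions to $\{i,j,k\}$ are $ijk,\,jki,\,kij$ or $kji,\,jik,\,ikj$. * $\mathcal D$ is a *peak-pit domain* if for every triple $i<j<k$ in $[n]$ the restrictions of the members of $\mathcal D$ to $\{i,j,k\}$ all lie in $\{ijk,ikj,kij,kji\}$ or all lie in $\{ijk,jik,jki,kji\}$. * $\mathcal D$ is *semi-connected* if $\alpha$ and $\omega$ are joined by a path in the Bruhat graph all of whose vertices (including $\alpha$ and $\omega$) belong to $\mathcal D$. Fix vectors $\xi_1,\dots,\xi_n$ of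 equal length in the open upper half-plane $\mathbb R\times\mathbb R_{>0}$ that go in this order (strictly) clockwise around the origin, and let $Z=\{\sum_i a_i\xi_i : 0\le a_i\le 1\}$ be the zonogon they generate. A tile is a translate of a rhombus $[0,\xi_i]+[0,\xi_j]$ with $i<j$. A *rhombus tiling* $T$ of $Z$ is a finite set of tiles with union $Z$ such that any two distinct tiles that meet do so in a single common vertex or in a single common (closed) edge. The vertices and edges of the tiles form a digraph $G_T$ in which every edge is directed upward; an edge that is a translate of $[0,\xi_i]$ has colour $i$. A *snake* of $T$ is a maximal directed path of $G_T$, and $\Sigma(T)$ is the set of the linear orders $x_1\dots x_n$ on $[n]$ that occur as the sequence of edge colours along a snake of $T$. A *domain of tiling type* is a domain $\Sigma(T)$, where $T$ is a rhombus tiling of $Z$. **Theorem 4.** (i) Every domain of tiling type is semi-connected. (ii) Every semi-connected Condorcet domain is a peak-pit domain. (iii) Every peak-pit domain is contained in a domain of tiling type. -/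

import Mathlib

namespace CondorcetTiling

/-! ### Linear orders, the weak Bruhat order and the Bruhat graph -/

/-- A linear order `x₁ < x₂ < ⋯ < xₙ` on the `n` alternatives, encoded by the word `x₁ x₂ … xₙ`:
the permutation sends a position to the alternative in that position (the first one is the worst,
the last one is the best). The alternatives `1, …, n` are the elements of `Fin n`. -/
abbrev LinOrd (n : ℕ) : Type := Equiv.Perm (Fin n)

/-- `i <_σ j`: the alternative `i` occurs before `j` in the word `σ`. -/
def LinOrd.Less {n : ℕ} (σ : LinOrd n) (i j : Fin n) : Prop := σ.symm i < σ.symm j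

/-- The order `1 < 2 < ⋯ < n`. -/
def alpha (n : ℕ) : LinOrd n := Equiv.refl (Fin n)

/-- The reversed order `n < n - 1 < ⋯ < 1`. -/
def omega (n : ℕ) : LinOrd n := Fin.revPerm

/-- The set of inversions of `σ`. -/
def Inv {n : ℕ} (σ : LinOrd n) : Set (Fin n × Fin n) :=
  {p | p.1 < p.2 ∧ σ.Less p.2 p.1}

/-- `Covers σ τ`: the order `τ` covers `σ`, i.e. `Inv τ` is `Inv σ` plus exactly one inversion. -/
def Covers {n : ℕ} (σ τ : LinOrd n) : Prop :=
  ∃ p, p ∉ Inv σ ∧ Inv τ = insert p (Inv σ)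

/-- The Bruhat graph: the underlying undirected graph of the cover relation. -/
def bruhatGraph (n : ℕ) : SimpleGraph (LinOrd n) := SimpleGraph.fromRel Covers

/-! ### Domains -/

/-- The restriction of `σ` to `{i, j, k}` is the word `ijk`. -/
def RestrictsTo {n : ℕ} (σ : LinOrd n) (i j k : Fin n) : Prop :=
  σ.Less i j ∧ σ.Less j k

/-- A set of linear orders is cyclic if, for some alternatives `i, j, k`, it has three members
whose restrictions to `{i, j, k}` are `ijk, jki, kij` or `kji, jik, ikj`. -/
def IsCyclic {n : ℕ} (D : Set (LinOrd n)) : Prop :=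
  ∃ i j k : Fin n, ∃ σ₁ ∈ D, ∃ σ₂ ∈ D, ∃ σ₃ ∈ D,
    (RestrictsTo σ₁ i j k ∧ RestrictsTo σ₂ j k i ∧ RestrictsTo σ₃ k i j) ∨
    (RestrictsTo σ₁ k j i ∧ RestrictsTo σ₂ j i k ∧ RestrictsTo σ₃ i k j)

/-- Condorcet domains are the acyclic sets of linear orders. -/
def IsCondorcetDomain {n : ℕ} (D : Set (LinOrd n)) : Prop := ¬ IsCyclic D

/-- The restriction of `σ` to `ijk` (where `i < j < k`) lies in the peak domain
`{ijk, ikj, kij, kji}`. -/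
def InPeak {n : ℕ} (σ : LinOrd n) (i j k : Fin n) : Prop :=
  RestrictsTo σ i j k ∨ RestrictsTo σ i k j ∨ RestrictsTo σ k i j ∨ RestrictsTo σ k j i

/-- The restriction of `σ` to `ijk` (where `i < j < k`) lies in the pit domain
`{ijk, jik, jki, kji}`. -/
def InPit {n : ℕ} (σ : LinOrd n) (i j k : Fin n) : Prop :=
  RestrictsTo σ i j k ∨ RestrictsTo σ j i k ∨ RestrictsTo σ j k i ∨ RestrictsTo σ k j i

/-- Peak-pit domains: on each triple `i < j < k`, all members satisfy the peak condition or all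
members satisfy the pit condition. -/
def IsPeakPit {n : ℕ} (D : Set (LinOrd n)) : Prop :=
  ∀ i j k : Fin n, i < j → j < k →
    (∀ σ ∈ D, InPeak σ i j k) ∨ (∀ σ ∈ D, InPit σ i j k)

/-- Semi-connected domains: some path of the Bruhat graph from `α` to `ω` has all its vertices
(the two ends included) in `D`. -/
def IsSemiConnected {n : ℕ} (D : Set (LinOrd n)) : Prop :=
  ∃ p : (bruhatGraph n).Walk (alpha n) (omega n), p.IsPath ∧ ∀ σ ∈ p.support, σ ∈ D

/-! ### Zonogons and rhombus tilings -/

/-- The vectors `ξ₁, …, ξₙ` that generate a zonogon: they lie in the open upper half-plane, have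
the same length, and go in this order clockwise around the origin. (For vectors `ξ, η` in the open
upper half-plane, `η` is strictly clockwise from `ξ` iff `det (ξ, η) < 0`.) -/
structure ZonogonVectors (n : ℕ) where
  vec : Fin n → ℝ × ℝ
  upper : ∀ i, 0 < (vec i).2
  same_length : ∀ i j, (vec i).1 ^ 2 + (vec i).2 ^ 2 = (vec j).1 ^ 2 + (vec j).2 ^ 2
  clockwise : ∀ i j, i < j → (vec i).1 * (vec j).2 - (vec i).2 * (vec j).1 < 0

/-- The zonogon: the sum of the segments `[0, ξᵢ]`. -/
def zonogon {n : ℕ} (ξ : ZonogonVectors n) : Set (ℝ × ℝ) :=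
  {x | ∃ a : Fin n → ℝ, (∀ i, 0 ≤ a i ∧ a i ≤ 1) ∧ x = ∑ i, a i • ξ.vec i}

/-- An `ij`-tile, `i < j`: the translate by `base` of the rhombus `[0, ξᵢ] + [0, ξⱼ]`. -/
structure Tile (n : ℕ) where
  base : ℝ × ℝ
  i : Fin n
  j : Fin n
  lt : i < j

/-- The closed rhombus occupied by a tile. -/
def Tile.carrier {n : ℕ} (ξ : ZonogonVectors n) (t : Tile n) : Set (ℝ × ℝ) :=
  {x | ∃ a b : ℝ, (0 ≤ a ∧ a ≤ 1) ∧ (0 ≤ b ∧ b ≤ 1) ∧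
    x = t.base + a • ξ.vec t.i + b • ξ.vec t.j}

/-- The four vertices of a tile. -/
def Tile.vertices {n : ℕ} (ξ : ZonogonVectors n) (t : Tile n) : Set (ℝ × ℝ) :=
  {t.base, t.base + ξ.vec t.i, t.base + ξ.vec t.j, t.base + ξ.vec t.i + ξ.vec t.j}

/-- The four edges of a tile. The pair `(p, c)` is the edge of colour `c` that goes upward from
`p` to `p + ξ_c`. -/
def Tile.edges {n : ℕ} (ξ : ZonogonVectors n) (t : Tile n) : Set ((ℝ × ℝ) × Fin n) :=
  {(t.base, t.i), (t.base + ξ.vec t.j, t.i), (t.base, t.j), (t.base + ξ.vec t.i, t.j)}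

/-- The closed segment of the edge `(p, c)`. -/
def edgeSegment {n : ℕ} (ξ : ZonogonVectors n) (e : (ℝ × ℝ) × Fin n) : Set (ℝ × ℝ) :=
  segment ℝ e.1 (e.1 + ξ.vec e.2)

/-- A rhombus tiling of the zonogon: finitely many tiles which together fill the zonogon and such
that two distinct tiles that meet do so in a single common vertex or in a single common edge. -/
structure IsTiling {n : ℕ} (ξ : ZonogonVectors n) (T : Finset (Tile n)) : Prop where
  cover : (⋃ t ∈ T, t.carrier ξ) = zonogon ξ
  inter : ∀ s ∈ T, ∀ t ∈ T, s ≠ t → (s.carrier ξ ∩ t.carrier ξ).Nonempty →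
    (∃ p ∈ s.vertices ξ ∩ t.vertices ξ, s.carrier ξ ∩ t.carrier ξ = {p}) ∨
    (∃ e ∈ s.edges ξ ∩ t.edges ξ, s.carrier ξ ∩ t.carrier ξ = edgeSegment ξ e)

/-- The vertices of the digraph of a tiling. -/
def graphVertices {n : ℕ} (ξ : ZonogonVectors n) (T : Finset (Tile n)) : Set (ℝ × ℝ) :=
  ⋃ t ∈ T, t.vertices ξ

/-- The coloured edges, oriented upward, of the digraph of a tiling. -/
def graphEdges {n : ℕ} (ξ : ZonogonVectors n) (T : Finset (Tile n)) :
    Set ((ℝ × ℝ) × Fin n) :=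
  ⋃ t ∈ T, t.edges ξ

/-- `DirPath ξ T p l q`: the digraph of `T` has a directed path from `p` to `q` whose sequence of
edge colours is `l`. -/
inductive DirPath {n : ℕ} (ξ : ZonogonVectors n) (T : Finset (Tile n)) :
    ℝ × ℝ → List (Fin n) → ℝ × ℝ → Prop
  | nil (p : ℝ × ℝ) (hp : p ∈ graphVertices ξ T) : DirPath ξ T p [] p
  | cons (p : ℝ × ℝ) (c : Fin n) (l : List (Fin n)) (q : ℝ × ℝ)
      (hc : (p, c) ∈ graphEdges ξ T) (hl : DirPath ξ T (p + ξ.vec c) l q) :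
      DirPath ξ T p (c :: l) q

/-- `l` is the sequence of edge colours of a snake, i.e. of a maximal directed path: no edge of
the digraph enters its first vertex and none leaves its last vertex. -/
def IsSnake {n : ℕ} (ξ : ZonogonVectors n) (T : Finset (Tile n)) (l : List (Fin n)) : Prop :=
  ∃ p q, DirPath ξ T p l q ∧
    (∀ e ∈ graphEdges ξ T, e.1 + ξ.vec e.2 ≠ p) ∧ (∀ e ∈ graphEdges ξ T, e.1 ≠ q)

/-- `Σ(T)`: the linear orders that are given by the colours along the snakes of `T`. -/
def snakeOrders {n : ℕ} (ξ : ZonogonVectors n) (T : Finset (Tile n)) : Set (LinOrd n) :=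
  {σ | IsSnake ξ T (List.ofFn σ)}

/-- Domains of tiling type: the domains `Σ(T)` for rhombus tilings `T` of the zonogon. -/
def IsTilingType {n : ℕ} (ξ : ZonogonVectors n) (D : Set (LinOrd n)) : Prop :=
  ∃ T : Finset (Tile n), IsTiling ξ T ∧ D = snakeOrders ξ T

end CondorcetTiling

namespace CondorcetTiling

variable {n : ℕ}

/-! (i) A tiling contains the whole left boundary path of the zonogon: a tile covering the beginning
of a boundary edge can follow the supporting line there only along an edge of its own
(`IsTiling.edgesIn_alpha`). A path of the tiling that is not the rightmost one runs along both left
edges of some tile (`IsTiling.exists_flip`). Pushing it across to the right edges inverts one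
adjacent pair, and this can be repeated until ω is reached.

(ii) On a Bruhat path from α to ω, some step inverts the extreme pair of i < j < k. Only that pair
changes, so j lies before both or after both. If j lies before both, a member violating the pit
condition completes a cyclic triple with α or ω and one end of the step; if j lies after both, a
member violating the peak condition does.

(iii) On a triple, the peak and pit conditions are chains of implications between inversions, so
they survive unions and intersections of inversion sets. In a maximal peak-pit domain these
operations therefore produce further members (`exists_Inv_eq_union_inter`), and a minimality
argument gives a flip out of every member except ω (`exists_flip_of_maximal`). The resulting chain
of flips sweeps the zonogon from left to right, adding one tile per flip; viewing paths as graphs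
over the height shows that these tiles form a tiling (`IsTileChain.isTiling`). Finally, the
inversion sets on a triple are linearly ordered, which forces each edge on the path of a member to
occur on some path of the chain (`IsPeakPit.exists_before_eq`), so every member is a snake order. -/

theorem LinOrd.Less.asymm {σ : LinOrd n} {i j : Fin n} (h : σ.Less i j) : ¬ σ.Less j i :=
  not_lt.mpr (le_of_lt h)

theorem LinOrd.Less.trans {σ : LinOrd n} {i j k : Fin n} (h : σ.Less i j) (h' : σ.Less j k) :
    σ.Less i k := lt_trans h h'

theorem LinOrd.less_or_less (σ : LinOrd n) {i j : Fin n} (h : i ≠ j) :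
    σ.Less i j ∨ σ.Less j i :=
  lt_or_gt_of_ne fun h' => h (σ.symm.injective h')

theorem LinOrd.not_less_iff (σ : LinOrd n) {i j : Fin n} (h : i ≠ j) :
    ¬ σ.Less i j ↔ σ.Less j i :=
  ⟨fun h' => (σ.less_or_less h).resolve_left h', fun h' => h'.asymm⟩

theorem alpha_less {i j : Fin n} : (alpha n).Less i j ↔ i < j := Iff.rfl

theorem omega_less {i j : Fin n} : (omega n).Less i j ↔ j < i := by
  simp [LinOrd.Less, omega]

theorem mem_Inv {σ : LinOrd n} {i j : Fin n} : (i, j) ∈ Inv σ ↔ i < j ∧ σ.Less j i := Iff.rfl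

/-- Comparing positions in the two words gives a strictly increasing self-map of `Fin n`, and the
only order automorphism of `Fin n` is the identity. -/
theorem LinOrd.ext_less {σ τ : LinOrd n} (h : ∀ i j, σ.Less i j → τ.Less i j) : σ = τ := by
  have hm : StrictMono (fun k => τ.symm (σ k)) := by
    intro a b hab
    exact h _ _ (by simpa [LinOrd.Less] using hab)
  have key : ∀ k, τ.symm (σ k) = k := by
    intro k
    have := Subsingleton.elim (StrictMono.orderIsoOfSurjective _ hm
      (τ.symm.surjective.comp σ.surjective)) (OrderIso.refl (Fin n))
    exact congrArg (fun e : Fin n ≃o Fin n => e k) this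
  exact Equiv.ext fun k => (Equiv.symm_apply_eq τ).mp (key k)

theorem LinOrd.ext_Inv {σ τ : LinOrd n} (h : Inv σ = Inv τ) : σ = τ := by
  have key : ∀ i j, i < j → (σ.Less j i ↔ τ.Less j i) := by
    intro i j hij
    have := Set.ext_iff.mp h (i, j)
    simpa [mem_Inv, hij] using this
  apply LinOrd.ext_less
  intro i j hij
  rcases lt_trichotomy i j with h1 | h1 | h1
  · rw [← LinOrd.not_less_iff _ h1.ne', ← key i j h1]
    exact hij.asymm
  · subst h1; exact absurd hij (lt_irrefl _)
  · exact (key j i h1).mp hij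

/-! ### Peak and pit conditions in terms of inversions -/

/-- The four peak words have inversion sets ∅, {jk}, {ik, jk} and all three pairs, a chain.
Expressing it by implications makes closure under union and intersection immediate; `inPit_iff` is
the mirror image, with ij and jk exchanged. -/
theorem inPeak_iff {σ : LinOrd n} {i j k : Fin n} (hij : i < j) (hjk : j < k) :
    InPeak σ i j k ↔ (σ.Less j i → σ.Less k i) ∧ (σ.Less k i → σ.Less k j) := by
  have a1 := σ.not_less_iff hij.ne
  have a2 := σ.not_less_iff hjk.ne
  have a3 := σ.not_less_iff (hij.trans hjk).ne
  have t1 := @LinOrd.Less.trans n σ i j k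
  have t2 := @LinOrd.Less.trans n σ k j i
  unfold InPeak RestrictsTo
  tauto

theorem inPit_iff {σ : LinOrd n} {i j k : Fin n} (hij : i < j) (hjk : j < k) :
    InPit σ i j k ↔ (σ.Less k j → σ.Less k i) ∧ (σ.Less k i → σ.Less j i) := by
  have a1 := σ.not_less_iff hij.ne
  have a2 := σ.not_less_iff hjk.ne
  have a3 := σ.not_less_iff (hij.trans hjk).ne
  have t1 := @LinOrd.Less.trans n σ i j k
  have t2 := @LinOrd.Less.trans n σ k j i
  unfold InPit RestrictsTo
  tauto

/-! ### Semi-connected Condorcet domains are peak-pit domains -/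

/-- A discrete intermediate value principle, used to find the step at which a given pair becomes
inverted. -/
theorem exists_adj_of_walk {V : Type*} {G : SimpleGraph V} (P : V → Prop) {u v : V}
    (p : G.Walk u v) (hu : P u) (hv : ¬ P v) :
    ∃ a ∈ p.support, ∃ b ∈ p.support, G.Adj a b ∧ P a ∧ ¬ P b := by
  induction p with
  | nil => exact absurd hu hv
  | @cons u w v h p ih =>
    by_cases hw : P w
    · obtain ⟨a, ha, b, hb, hab⟩ := ih hw hv
      exact ⟨a, by simp [ha], b, by simp [hb], hab⟩
    · exact ⟨u, by simp, w, by simp, h, hu, hw⟩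

theorem Covers.less_iff {σ τ : LinOrd n} (h : Covers σ τ) {i j a b : Fin n} (hij : i < j)
    (hab : a < b) (hne : (i, j) ≠ (a, b)) (h1 : σ.Less i j) (h2 : τ.Less j i) :
    σ.Less b a ↔ τ.Less b a := by
  obtain ⟨p, hp, hI⟩ := h
  have e1 : (i, j) = p := by
    have : (i, j) ∈ Inv τ := ⟨hij, h2⟩
    rw [hI] at this
    rcases this with h | h
    · exact h
    · exact absurd h.2 h1.asymm
  have e2 : (a, b) ∈ Inv τ ↔ (a, b) ∈ Inv σ := by
    rw [hI, Set.mem_insert_iff, ← e1]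
    simp [hne.symm]
  simpa [mem_Inv, hab] using e2.symm

/-- A step down the cover relation cannot create an inversion, so the newly inverted pair shows that
the step goes up and is its only change. -/
theorem adj_less_iff {σ τ : LinOrd n} (h : (bruhatGraph n).Adj σ τ) {i j a b : Fin n}
    (hij : i < j) (hab : a < b) (hne : (i, j) ≠ (a, b)) (h1 : σ.Less i j) (h2 : τ.Less j i) :
    σ.Less b a ↔ τ.Less b a := by
  rcases (SimpleGraph.fromRel_adj _ _ _).mp h with ⟨-, h | h⟩
  · exact h.less_iff hij hab hne h1 h2
  · obtain ⟨p, hp, hI⟩ := h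
    exfalso
    have : (i, j) ∈ Inv σ := by rw [hI]; exact Or.inr ⟨hij, h2⟩
    exact h1.asymm this.2

theorem IsSemiConnected.isPeakPit {D : Set (LinOrd n)} (hC : IsCondorcetDomain D)
    (hS : IsSemiConnected D) : IsPeakPit D := by
  intro i j k hij hjk
  have hik := hij.trans hjk
  obtain ⟨p, -, hp⟩ := hS
  have hα : alpha n ∈ D := hp _ p.start_mem_support
  have hω : omega n ∈ D := hp _ p.end_mem_support
  obtain ⟨u, hu, v, hv, hadj, hui, hvi⟩ := exists_adj_of_walk (fun σ => σ.Less i k) p hik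
    (fun h => (omega_less.mp h).asymm hik)
  replace hu := hp _ hu
  replace hv := hp _ hv
  rw [LinOrd.not_less_iff _ hik.ne] at hvi
  have e1 := adj_less_iff hadj hik hij (by simp [hjk.ne']) hui hvi
  have e2 := adj_less_iff hadj hik hjk (by simp [hij.ne]) hui hvi
  by_contra hcon
  simp only [not_or, not_forall] at hcon
  obtain ⟨⟨σ, hσ, hσ'⟩, ⟨τ, hτ, hτ'⟩⟩ := hcon
  have hα1 : RestrictsTo (alpha n) i j k := ⟨hij, hjk⟩
  have hω1 : RestrictsTo (omega n) k j i := ⟨omega_less.mpr hjk, omega_less.mpr hij⟩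
  have six : ∀ ρ : LinOrd n, RestrictsTo ρ i j k ∨ RestrictsTo ρ i k j ∨ RestrictsTo ρ k i j ∨
      RestrictsTo ρ k j i ∨ RestrictsTo ρ j i k ∨ RestrictsTo ρ j k i := by
    intro ρ
    rcases ρ.less_or_less hij.ne with a | a <;> rcases ρ.less_or_less hjk.ne with b | b <;>
      rcases ρ.less_or_less hik.ne with c | c <;> simp [RestrictsTo, a, b, c]
  have h1 : RestrictsTo σ j i k ∨ RestrictsTo σ j k i := by
    unfold InPeak at hσ'
    rcases six σ with h | h | h | h | h | h <;> simp_all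
  have h2 : RestrictsTo τ i k j ∨ RestrictsTo τ k i j := by
    unfold InPit at hτ'
    rcases six τ with h | h | h | h | h | h <;> simp_all
  -- The step from `u` to `v` inverts only ik; having j between i and k would contradict
  -- transitivity in `u` or `v`.
  have huv : (RestrictsTo u j i k ∧ RestrictsTo v j k i) ∨
      (RestrictsTo u i k j ∧ RestrictsTo v k i j) := by
    rcases u.less_or_less hij.ne with a | a <;> rcases u.less_or_less hjk.ne with b | b
    · have a' := (v.not_less_iff hij.ne').mp fun h => a.asymm (e1.mpr h)
      have b' := (v.not_less_iff hjk.ne').mp fun h => b.asymm (e2.mpr h)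
      exact absurd (a'.trans b') hvi.asymm
    · exact Or.inr ⟨⟨hui, b⟩, hvi, (v.not_less_iff hij.ne').mp fun h => a.asymm (e1.mpr h)⟩
    · exact Or.inl ⟨⟨a, hui⟩, (v.not_less_iff hjk.ne').mp fun h => b.asymm (e2.mpr h), hvi⟩
    · exact absurd (b.trans a) hui.asymm
  apply hC
  rcases huv with ⟨q1, q2⟩ | ⟨q1, q2⟩
  · rcases h2 with h2 | h2
    · exact ⟨i, j, k, omega n, hω, u, hu, τ, hτ, Or.inr ⟨hω1, q1, h2⟩⟩
    · exact ⟨i, j, k, alpha n, hα, v, hv, τ, hτ, Or.inl ⟨hα1, q2, h2⟩⟩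
  · rcases h1 with h1 | h1
    · exact ⟨i, j, k, omega n, hω, σ, hσ, u, hu, Or.inr ⟨hω1, h1, q1⟩⟩
    · exact ⟨i, j, k, alpha n, hα, σ, hσ, v, hv, Or.inl ⟨hα1, h1, q2⟩⟩

/-! ### Flips of adjacent alternatives -/

/-- `τ` is obtained from `σ` by exchanging the alternatives `i < j`, where `j` comes immediately
after `i` in `σ`. -/
structure IsFlip (σ τ : LinOrd n) (i j : Fin n) : Prop where
  lt : i < j
  adjacent : (σ.symm j : ℕ) = σ.symm i + 1
  eq : τ = σ.trans (Equiv.swap i j)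

/-- The set of the first `k` alternatives of `σ`. -/
def prefixSet (σ : LinOrd n) (k : ℕ) : Finset (Fin n) :=
  Finset.univ.filter fun a => (σ.symm a : ℕ) < k

theorem mem_prefixSet {σ : LinOrd n} {k : ℕ} {a : Fin n} :
    a ∈ prefixSet σ k ↔ (σ.symm a : ℕ) < k := by simp [prefixSet]

/-- The set of the alternatives that come before `c` in `σ`. -/
def before (σ : LinOrd n) (c : Fin n) : Finset (Fin n) := prefixSet σ (σ.symm c)

theorem mem_before {σ : LinOrd n} {a c : Fin n} : a ∈ before σ c ↔ σ.Less a c := by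
  simp [before, mem_prefixSet, LinOrd.Less]

theorem prefixSet_zero (σ : LinOrd n) : prefixSet σ 0 = ∅ := by
  ext; simp [mem_prefixSet]

theorem prefixSet_self (σ : LinOrd n) : prefixSet σ n = Finset.univ := by
  ext; simp [mem_prefixSet]

theorem prefixSet_succ (σ : LinOrd n) (k : Fin n) :
    prefixSet σ (k + 1) = insert (σ k) (prefixSet σ k) := by
  ext a
  simp only [mem_prefixSet, Finset.mem_insert]
  rw [← Equiv.symm_apply_eq, Fin.ext_iff]
  omega

theorem notMem_before (σ : LinOrd n) (c : Fin n) : c ∉ before σ c := by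
  simp [mem_before, LinOrd.Less]

namespace IsFlip

variable {σ τ : LinOrd n} {i j : Fin n}

theorem symm_left (h : IsFlip σ τ i j) : τ.symm i = σ.symm j := by
  simp [h.eq]

theorem symm_right (h : IsFlip σ τ i j) : τ.symm j = σ.symm i := by
  simp [h.eq]

theorem symm_of_ne (h : IsFlip σ τ i j) {c : Fin n} (hi : c ≠ i) (hj : c ≠ j) :
    τ.symm c = σ.symm c := by
  simp [h.eq, Equiv.swap_apply_of_ne_of_ne hi hj]

theorem less (h : IsFlip σ τ i j) : σ.Less i j := by
  have := h.adjacent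
  simp only [LinOrd.Less, Fin.lt_def]
  omega

theorem less_symm (h : IsFlip σ τ i j) : τ.Less j i := by
  have := h.less
  simpa [LinOrd.Less, h.symm_left, h.symm_right] using this

theorem less_iff (h : IsFlip σ τ i j) {a b : Fin n} (h1 : ¬ (a = i ∧ b = j))
    (h2 : ¬ (a = j ∧ b = i)) : τ.Less a b ↔ σ.Less a b := by
  have hadj := h.adjacent
  have hij := h.lt.ne
  have inj : ∀ c, c ≠ i → c ≠ j → (σ.symm c : ℕ) ≠ σ.symm i ∧ (σ.symm c : ℕ) ≠ σ.symm j := by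
    intro c ci cj
    exact ⟨fun e => ci (σ.symm.injective (Fin.ext e)), fun e => cj (σ.symm.injective (Fin.ext e))⟩
  simp only [LinOrd.Less, Fin.lt_def]
  by_cases ai : a = i
  · subst ai
    by_cases bi : b = a
    · subst bi; simp
    · have bj : b ≠ j := fun e => h1 ⟨rfl, e⟩
      rw [h.symm_left, h.symm_of_ne bi bj]
      have := inj b bi bj
      omega
  · by_cases aj : a = j
    · subst aj
      by_cases bj : b = a
      · subst bj; simp
      · have bi : b ≠ i := fun e => h2 ⟨rfl, e⟩
        rw [h.symm_right, h.symm_of_ne bi bj]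
        have := inj b bi bj
        omega
    · rw [h.symm_of_ne ai aj]
      by_cases bi : b = i
      · subst bi
        rw [h.symm_left]
        have := inj a ai aj
        omega
      · by_cases bj : b = j
        · subst bj
          rw [h.symm_right]
          have := inj a ai aj
          omega
        · rw [h.symm_of_ne bi bj]

theorem Inv_eq (h : IsFlip σ τ i j) : Inv τ = insert (i, j) (Inv σ) := by
  ext ⟨a, b⟩
  rw [Set.mem_insert_iff, mem_Inv, mem_Inv, Prod.mk.injEq]
  by_cases h1 : a = i ∧ b = j
  · obtain ⟨rfl, rfl⟩ := h1
    simp [h.lt, h.less_symm]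
  · simp only [h1, false_or]
    by_cases h2 : b = i ∧ a = j
    · obtain ⟨rfl, rfl⟩ := h2
      simp [h.lt.not_gt]
    · rw [h.less_iff (fun e => h2 e) (fun e => h1 ⟨e.2, e.1⟩)]

theorem notMem_Inv (h : IsFlip σ τ i j) : (i, j) ∉ Inv σ := fun e => h.less.asymm e.2

theorem covers (h : IsFlip σ τ i j) : Covers σ τ := ⟨(i, j), h.notMem_Inv, h.Inv_eq⟩

theorem before_of_ne (h : IsFlip σ τ i j) {c : Fin n} (hi : c ≠ i) (hj : c ≠ j) :
    before τ c = before σ c := by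
  ext a
  rw [mem_before, mem_before, h.less_iff (fun e => hj e.2) (fun e => hi e.2)]

theorem before_right' (h : IsFlip σ τ i j) : before τ j = before σ i := by
  ext a
  rw [mem_before, mem_before]
  have hadj := h.adjacent
  simp only [LinOrd.Less, Fin.lt_def, h.symm_right]
  by_cases ai : a = i
  · subst ai; rw [h.symm_left]; omega
  · by_cases aj : a = j
    · subst aj; rw [h.symm_right]; omega
    · rw [h.symm_of_ne ai aj]

theorem before_right (h : IsFlip σ τ i j) : before σ j = insert i (before σ i) := by
  ext a
  rw [Finset.mem_insert, mem_before, mem_before]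
  have hadj := h.adjacent
  simp only [LinOrd.Less, Fin.lt_def]
  by_cases ai : a = i
  · subst ai; simp; omega
  · have : (σ.symm a : ℕ) ≠ σ.symm i := fun e => ai (σ.symm.injective (Fin.ext e))
    simp only [ai, false_or]; omega

theorem before_left (h : IsFlip σ τ i j) : before τ i = insert j (before σ i) := by
  ext a
  rw [Finset.mem_insert, mem_before, mem_before]
  have hadj := h.adjacent
  simp only [LinOrd.Less, Fin.lt_def, h.symm_left]
  by_cases aj : a = j
  · subst aj; simp [h.symm_right]; omega
  · by_cases ai : a = i
    · subst ai; simp [h.symm_left, aj]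
    · rw [h.symm_of_ne ai aj]
      have : (σ.symm a : ℕ) ≠ σ.symm i := fun e => ai (σ.symm.injective (Fin.ext e))
      simp only [aj, false_or]; omega

theorem right_notMem (h : IsFlip σ τ i j) : j ∉ before σ i := by
  rw [mem_before]; exact h.less.asymm

end IsFlip

theorem isFlip_of_adjacent {σ : LinOrd n} {i j : Fin n} (hij : i < j)
    (h : (σ.symm j : ℕ) = σ.symm i + 1) : IsFlip σ (σ.trans (Equiv.swap i j)) i j := ⟨hij, h, rfl⟩

/-- A sequence of flips from `α` to `ω` inside a set that allows a flip at each member but `ω`. -/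
theorem exists_flip_chain {D : Set (LinOrd n)} (hα : alpha n ∈ D)
    (step : ∀ σ ∈ D, σ ≠ omega n → ∃ τ ∈ D, ∃ i j, IsFlip σ τ i j) :
    ∃ (N : ℕ) (s : ℕ → LinOrd n), s 0 = alpha n ∧ s N = omega n ∧ (∀ m ≤ N, s m ∈ D) ∧
      ∀ m < N, ∃ i j, IsFlip (s m) (s (m + 1)) i j := by
  -- Induction on a bound for the number of pairs that are not inversions, which every flip
  -- decreases.
  have key : ∀ (r : ℕ) (σ : LinOrd n), σ ∈ D → (Inv σ)ᶜ.ncard ≤ r →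
      ∃ (N : ℕ) (s : ℕ → LinOrd n), s 0 = σ ∧ s N = omega n ∧ (∀ m ≤ N, s m ∈ D) ∧
        ∀ m < N, ∃ i j, IsFlip (s m) (s (m + 1)) i j := by
    intro r
    induction r with
    | zero =>
      intro σ hσ hr
      by_cases hω : σ = omega n
      · exact ⟨0, fun _ => σ, rfl, hω, fun _ _ => hσ, by simp⟩
      · obtain ⟨τ, -, i, j, h⟩ := step σ hσ hω
        have : (Inv σ)ᶜ = ∅ := (Set.ncard_eq_zero (Set.toFinite _)).mp (Nat.le_zero.mp hr)
        exact absurd (show (i, j) ∈ (Inv σ)ᶜ from h.notMem_Inv) (by simp [this])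
    | succ r ih =>
      intro σ hσ hr
      by_cases hω : σ = omega n
      · exact ⟨0, fun _ => σ, rfl, hω, fun _ _ => hσ, by simp⟩
      · obtain ⟨τ, hτ, i, j, h⟩ := step σ hσ hω
        have hlt : (Inv τ)ᶜ.ncard < (Inv σ)ᶜ.ncard := by
          refine Set.ncard_lt_ncard (compl_lt_compl_iff_lt.mpr ?_) (Set.toFinite _)
          rw [h.Inv_eq]
          exact Set.ssubset_insert h.notMem_Inv
        obtain ⟨N, s, h0, hN, hD, hs⟩ := ih τ hτ (by omega)
        refine ⟨N + 1, fun m => Nat.casesOn m σ s, rfl, hN, ?_, ?_⟩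
        · rintro (_ | m) hm
          · exact hσ
          · exact hD m (by omega)
        · rintro (_ | m) hm
          · exact ⟨i, j, by simpa [h0] using h⟩
          · exact hs m (by omega)
  exact key _ _ hα le_rfl

theorem isSemiConnected_of_step {D : Set (LinOrd n)} (hα : alpha n ∈ D)
    (step : ∀ σ ∈ D, σ ≠ omega n → ∃ τ ∈ D, ∃ i j, IsFlip σ τ i j) : IsSemiConnected D := by
  classical
  obtain ⟨N, s, h0, hN, hD, hs⟩ := exists_flip_chain hα step
  have key : ∀ m ≤ N, ∃ p : (bruhatGraph n).Walk (alpha n) (s m), ∀ σ ∈ p.support, σ ∈ D := by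
    intro m
    induction m with
    | zero =>
      intro _
      rw [h0]
      exact ⟨SimpleGraph.Walk.nil, by simpa using hα⟩
    | succ m ih =>
      intro hm
      obtain ⟨p, hp⟩ := ih (by omega)
      obtain ⟨i, j, h⟩ := hs m (by omega)
      have hadj : (bruhatGraph n).Adj (s m) (s (m + 1)) := by
        refine (SimpleGraph.fromRel_adj _ _ _).mpr ⟨fun e => ?_, Or.inl h.covers⟩
        have h1 := h.less
        rw [e] at h1
        exact h1.asymm h.less_symm
      refine ⟨p.concat hadj, fun σ hσ => ?_⟩
      rw [SimpleGraph.Walk.support_concat] at hσ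
      simp only [List.mem_append, List.mem_singleton] at hσ
      rcases hσ with hσ | hσ
      · exact hp σ hσ
      · exact hσ ▸ hD _ hm
  obtain ⟨p, hp⟩ : ∃ p : (bruhatGraph n).Walk (alpha n) (omega n), ∀ σ ∈ p.support, σ ∈ D := by
    have := key N le_rfl
    rwa [hN] at this
  -- The walk may be shortened to a path, as this only removes vertices.
  exact ⟨p.bypass, p.bypass_isPath, fun σ hσ => hp σ (p.support_bypass_subset_support hσ)⟩

end CondorcetTiling

namespace CondorcetTiling

variable {n : ℕ}

/-! ### Points of zonogons and tiles -/

/-- The point of the zonogon that belongs to a set of alternatives. -/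
def sumVec (ξ : ZonogonVectors n) (A : Finset (Fin n)) : ℝ × ℝ := ∑ a ∈ A, ξ.vec a

/-- All edges of the path of `σ` are edges of the tiling. -/
def EdgesIn (ξ : ZonogonVectors n) (T : Finset (Tile n)) (σ : LinOrd n) : Prop :=
  ∀ c, (sumVec ξ (before σ c), c) ∈ graphEdges ξ T

variable {ξ : ZonogonVectors n} {T : Finset (Tile n)} {σ : LinOrd n}

theorem sumVec_insert {A : Finset (Fin n)} {c : Fin n} (h : c ∉ A) :
    sumVec ξ (insert c A) = sumVec ξ A + ξ.vec c := by
  rw [sumVec, Finset.sum_insert h, add_comm]; rfl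

theorem sumVec_prefixSet_succ (k : Fin n) :
    sumVec ξ (prefixSet σ (k + 1)) = sumVec ξ (prefixSet σ k) + ξ.vec (σ k) := by
  rw [prefixSet_succ, sumVec_insert]
  simp [mem_prefixSet]

theorem before_apply (k : Fin n) : before σ (σ k) = prefixSet σ k := by simp [before]

theorem sumVec_fst (A : Finset (Fin n)) : (sumVec ξ A).1 = ∑ a ∈ A, (ξ.vec a).1 := Prod.fst_sum

theorem sumVec_snd (A : Finset (Fin n)) : (sumVec ξ A).2 = ∑ a ∈ A, (ξ.vec a).2 := Prod.snd_sum

theorem mem_graphEdges {e : (ℝ × ℝ) × Fin n} :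
    e ∈ graphEdges ξ T ↔ ∃ t ∈ T, e ∈ t.edges ξ := by simp [graphEdges]

theorem mem_graphVertices {p : ℝ × ℝ} :
    p ∈ graphVertices ξ T ↔ ∃ t ∈ T, p ∈ t.vertices ξ := by simp [graphVertices]

namespace Tile

variable {t : Tile n}

theorem mem_vertices_of_mem_edges {e : (ℝ × ℝ) × Fin n} (h : e ∈ t.edges ξ) :
    e.1 ∈ t.vertices ξ ∧ e.1 + ξ.vec e.2 ∈ t.vertices ξ := by
  simp only [edges, Set.mem_insert_iff, Set.mem_singleton_iff] at h
  rcases h with rfl | rfl | rfl | rfl <;> simp [vertices, add_right_comm]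

theorem vertices_subset_carrier : t.vertices ξ ⊆ t.carrier ξ := by
  intro p hp
  simp only [vertices, Set.mem_insert_iff, Set.mem_singleton_iff] at hp
  rcases hp with rfl | rfl | rfl | rfl
  · exact ⟨0, 0, by norm_num, by norm_num, by simp⟩
  · exact ⟨1, 0, by norm_num, by norm_num, by simp⟩
  · exact ⟨0, 1, by norm_num, by norm_num, by simp⟩
  · exact ⟨1, 1, by norm_num, by norm_num, by simp⟩

theorem carrier_eq_image : t.carrier ξ =
    (fun x : ℝ × ℝ => t.base + x.1 • ξ.vec t.i + x.2 • ξ.vec t.j) ''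
      (Set.Icc 0 1 ×ˢ Set.Icc 0 1) := by
  ext p
  constructor
  · rintro ⟨a, b, ha, hb, rfl⟩
    exact ⟨(a, b), ⟨ha, hb⟩, rfl⟩
  · rintro ⟨⟨a, b⟩, ⟨ha, hb⟩, rfl⟩
    exact ⟨a, b, ha, hb, rfl⟩

theorem isClosed_carrier : IsClosed (t.carrier ξ) := by
  rw [carrier_eq_image]
  exact ((isCompact_Icc.prod isCompact_Icc).image (by fun_prop)).isClosed

theorem convex_carrier : Convex ℝ (t.carrier ξ) := by
  rintro p ⟨a, b, ha, hb, rfl⟩ q ⟨a', b', ha', hb', rfl⟩ x y hx hy hxy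
  refine ⟨x * a + y * a', x * b + y * b', ?_, ?_, ?_⟩
  · exact convex_Icc (0 : ℝ) 1 ha ha' hx hy hxy
  · exact convex_Icc (0 : ℝ) 1 hb hb' hx hy hxy
  · have : x = 1 - y := by linarith
    subst this
    module

theorem coord_inj {a b a' b' : ℝ} (h : t.base + a • ξ.vec t.i + b • ξ.vec t.j =
    t.base + a' • ξ.vec t.i + b' • ξ.vec t.j) : a = a' ∧ b = b' := by
  have hD := ξ.clockwise t.i t.j t.lt
  have h1 := congrArg Prod.fst h
  have h2 := congrArg Prod.snd h
  simp only [Prod.fst_add, Prod.smul_fst, smul_eq_mul, Prod.snd_add, Prod.smul_snd] at h1 h2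
  have e1 : (a - a') * ((ξ.vec t.i).1 * (ξ.vec t.j).2 - (ξ.vec t.i).2 * (ξ.vec t.j).1) = 0 := by
    linear_combination (ξ.vec t.j).2 * h1 - (ξ.vec t.j).1 * h2
  have e2 : (b - b') * ((ξ.vec t.i).1 * (ξ.vec t.j).2 - (ξ.vec t.i).2 * (ξ.vec t.j).1) = 0 := by
    linear_combination (ξ.vec t.i).1 * h2 - (ξ.vec t.i).2 * h1
  exact ⟨sub_eq_zero.mp ((mul_eq_zero.mp e1).resolve_right hD.ne),
    sub_eq_zero.mp ((mul_eq_zero.mp e2).resolve_right hD.ne)⟩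

/-- The left corner of a tile. -/
def leftCorner (ξ : ZonogonVectors n) (t : Tile n) : ℝ × ℝ := t.base + ξ.vec t.i

theorem exists_leftCorner_add_mem : ∃ w > 0, ∀ x, 0 ≤ x → x ≤ w →
    t.leftCorner ξ + (x, 0) ∈ t.carrier ξ := by
  have hD := ξ.clockwise t.i t.j t.lt
  have hi := ξ.upper t.i
  have hj := ξ.upper t.j
  set D := (ξ.vec t.i).1 * (ξ.vec t.j).2 - (ξ.vec t.i).2 * (ξ.vec t.j).1 with hDdef
  -- With η denoting second coordinates, the vector −ηⱼ ξᵢ + ηᵢ ξⱼ is horizontal of length −D and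
  -- points right. The chosen width keeps both tile coordinates in [0, 1].
  refine ⟨-D / ((ξ.vec t.i).2 + (ξ.vec t.j).2), by apply div_pos <;> linarith, fun x hx hxw => ?_⟩
  rw [le_div_iff₀ (by linarith)] at hxw
  have hx1 : x / -D * ((ξ.vec t.i).2 + (ξ.vec t.j).2) ≤ 1 := by
    rw [div_mul_eq_mul_div, div_le_one (by linarith)]; exact hxw
  have hx0 : 0 ≤ x / -D := div_nonneg hx (by linarith)
  refine ⟨1 - x / -D * (ξ.vec t.j).2, x / -D * (ξ.vec t.i).2, ⟨?_, ?_⟩, ⟨?_, ?_⟩, ?_⟩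
  · nlinarith
  · nlinarith
  · positivity
  · nlinarith
  · have hxe : x = x / -D * -D := by field_simp [hD.ne]
    refine Prod.ext ?_ ?_
    · simp only [leftCorner, Prod.fst_add, Prod.smul_fst, smul_eq_mul]
      linear_combination hxe + (x / -D) * hDdef
    · simp only [leftCorner, Prod.snd_add, Prod.smul_snd, smul_eq_mul]
      ring

end Tile

theorem sumVec_mem_zonogon_aux {A : Finset (Fin n)} {i j : Fin n} (hi : i ∉ A) (hj : j ∉ A)
    (hij : i < j) : (Tile.mk (sumVec ξ A) i j hij).carrier ξ ⊆ zonogon ξ := by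
  rintro p ⟨a, b, ha, hb, rfl⟩
  refine ⟨fun c => if c ∈ A then 1 else if c = i then a else if c = j then b else 0, ?_, ?_⟩
  · intro c
    dsimp only
    split_ifs
    · norm_num
    · exact ha
    · exact hb
    · norm_num
  · have e : ∀ c, (if c ∈ A then (1 : ℝ) else if c = i then a else if c = j then b else 0) • ξ.vec c
        = (if c ∈ A then ξ.vec c else 0) + (if c = i then a • ξ.vec c else 0) +
          (if c = j then b • ξ.vec c else 0) := by
      intro c
      by_cases h1 : c ∈ A
      · have h2 : c ≠ i := fun h => hi (h ▸ h1)
        have h3 : c ≠ j := fun h => hj (h ▸ h1)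
        simp [h1, h2, h3]
      · by_cases h2 : c = i
        · simp [h2, hi, hij.ne]
        · simp [h1, h2]
    simp only [e, Finset.sum_add_distrib]
    simp [sumVec]

theorem sumVec_mem_zonogon (A : Finset (Fin n)) : sumVec ξ A ∈ zonogon ξ := by
  refine ⟨fun c => if c ∈ A then 1 else 0, fun c => ?_, ?_⟩
  · dsimp only; split_ifs <;> norm_num
  · simp [sumVec, ite_smul]

theorem convex_zonogon : Convex ℝ (zonogon ξ) := by
  rintro p ⟨a, ha, rfl⟩ q ⟨b, hb, rfl⟩ x y hx hy hxy
  refine ⟨fun c => x * a c + y * b c, fun c => ?_, ?_⟩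
  · exact convex_Icc (0 : ℝ) 1 (ha c) (hb c) hx hy hxy
  · simp only [Finset.smul_sum, add_smul, mul_smul, Finset.sum_add_distrib]

theorem zonogon_snd_nonneg {p : ℝ × ℝ} (hp : p ∈ zonogon ξ) : 0 ≤ p.2 := by
  obtain ⟨a, ha, rfl⟩ := hp
  rw [Prod.snd_sum]
  exact Finset.sum_nonneg fun c _ => mul_nonneg (ha c).1 (ξ.upper c).le

theorem zonogon_snd_le {p : ℝ × ℝ} (hp : p ∈ zonogon ξ) :
    p.2 ≤ (sumVec ξ Finset.univ).2 := by
  obtain ⟨a, ha, rfl⟩ := hp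
  rw [Prod.snd_sum, sumVec_snd]
  exact Finset.sum_le_sum fun c _ => mul_le_of_le_one_left (ξ.upper c).le (ha c).2

theorem eq_zero_of_mem_zonogon {p : ℝ × ℝ} (hp : p ∈ zonogon ξ) (h : p.2 = 0) : p = 0 := by
  obtain ⟨a, ha, rfl⟩ := hp
  rw [Prod.snd_sum] at h
  have := (Finset.sum_eq_zero_iff_of_nonneg
    fun c _ => mul_nonneg (ha c).1 (ξ.upper c).le).mp h
  apply Finset.sum_eq_zero
  intro c hc
  have h0 : a c = 0 := (mul_eq_zero.mp (this c hc)).resolve_right (ξ.upper c).ne'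
  simp [h0]

theorem eq_top_of_mem_zonogon {p : ℝ × ℝ} (hp : p ∈ zonogon ξ)
    (h : p.2 = (sumVec ξ Finset.univ).2) : p = sumVec ξ Finset.univ := by
  obtain ⟨a, ha, rfl⟩ := hp
  rw [Prod.snd_sum, sumVec_snd] at h
  have := (Finset.sum_eq_sum_iff_of_le
    fun c _ => mul_le_of_le_one_left (ξ.upper c).le (ha c).2).mp h
  apply Finset.sum_congr rfl
  intro c hc
  have h0 : a c = 1 := mul_right_cancel₀ (ξ.upper c).ne' ((this c hc).trans (one_mul _).symm)
  simp [h0]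

/-! ### Snakes -/

theorem mem_zonogon_of_mem_graphEdges (hT : ∀ t ∈ T, t.carrier ξ ⊆ zonogon ξ)
    {e : (ℝ × ℝ) × Fin n} (he : e ∈ graphEdges ξ T) :
    e.1 ∈ zonogon ξ ∧ e.1 + ξ.vec e.2 ∈ zonogon ξ := by
  obtain ⟨t, ht, he⟩ := mem_graphEdges.mp he
  have := Tile.mem_vertices_of_mem_edges he
  exact ⟨hT t ht (Tile.vertices_subset_carrier this.1),
    hT t ht (Tile.vertices_subset_carrier this.2)⟩

/-- Downward induction on `k`, because `DirPath` grows at its lower end. The last edge, which exists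
as `n` is positive, shows that the top point is a vertex. -/
theorem EdgesIn.dirPath (hn : 0 < n) (h : EdgesIn ξ T σ) {k : ℕ} (hk : k ≤ n) :
    DirPath ξ T (sumVec ξ (prefixSet σ k)) ((List.ofFn σ).drop k) (sumVec ξ Finset.univ) := by
  induction hk using Nat.decreasingInduction with
  | self =>
    rw [prefixSet_self, List.drop_of_length_le (by simp)]
    refine DirPath.nil _ ?_
    obtain ⟨t, ht, he⟩ := mem_graphEdges.mp (h (σ ⟨n - 1, by omega⟩))
    refine mem_graphVertices.mpr ⟨t, ht, ?_⟩
    have := (Tile.mem_vertices_of_mem_edges he).2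
    rw [before_apply, ← sumVec_prefixSet_succ] at this
    simpa [Nat.sub_add_cancel hn, prefixSet_self] using this
  | of_succ k hk ih =>
    rw [List.drop_eq_getElem_cons (by simpa using hk)]
    have hk' := sumVec_prefixSet_succ (ξ := ξ) (σ := σ) ⟨k, hk⟩
    have he := h (σ ⟨k, hk⟩)
    rw [before_apply] at he
    simp only [List.getElem_ofFn]
    exact DirPath.cons _ _ _ _ he (hk' ▸ ih)

/-- The path is maximal because all edges go strictly upward inside the zonogon: none can end at its
lowest point or start at its highest. -/
theorem EdgesIn.mem_snakeOrders (hn : 0 < n) (hT : ∀ t ∈ T, t.carrier ξ ⊆ zonogon ξ)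
    (h : EdgesIn ξ T σ) : σ ∈ snakeOrders ξ T := by
  have hp := h.dirPath hn (Nat.zero_le n)
  rw [prefixSet_zero] at hp
  refine ⟨_, _, hp, fun e he h0 => ?_, fun e he h0 => ?_⟩
  · have h1 := zonogon_snd_nonneg (mem_zonogon_of_mem_graphEdges hT he).1
    have h2 := congrArg Prod.snd h0
    have h3 := ξ.upper e.2
    simp [sumVec] at h2
    linarith
  · have h1 := zonogon_snd_le (mem_zonogon_of_mem_graphEdges hT he).2
    have h3 := ξ.upper e.2
    rw [h0, Prod.snd_add] at h1
    linarith

/-- The flip trades the two left edges of the tile for its two right edges and leaves all other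
edges of the path in place. -/
theorem EdgesIn.of_isFlip {τ : LinOrd n} {i j : Fin n} (h : EdgesIn ξ T σ) (hf : IsFlip σ τ i j)
    (ht : (⟨sumVec ξ (before σ i), i, j, hf.lt⟩ : Tile n) ∈ T) : EdgesIn ξ T τ := by
  intro c
  by_cases hi : c = i
  · subst hi
    refine mem_graphEdges.mpr ⟨_, ht, ?_⟩
    rw [hf.before_left, sumVec_insert hf.right_notMem]
    simp [Tile.edges]
  · by_cases hj : c = j
    · subst hj
      refine mem_graphEdges.mpr ⟨_, ht, ?_⟩
      rw [hf.before_right']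
      simp [Tile.edges]
    · rw [hf.before_of_ne hi hj]
      exact h c

end CondorcetTiling

namespace CondorcetTiling

variable {n : ℕ} {ξ : ZonogonVectors n} {T : Finset (Tile n)} {σ : LinOrd n}

/-! ### Domains of tiling type are semi-connected -/

theorem IsTiling.carrier_subset (hT : IsTiling ξ T) {t : Tile n} (ht : t ∈ T) :
    t.carrier ξ ⊆ zonogon ξ := by
  rw [← hT.cover]
  exact Set.subset_biUnion_of_mem (u := fun t : Tile n => t.carrier ξ) ht

/-- Some tile contains an initial part of a segment of the zonogon. -/
theorem IsTiling.exists_tile (hT : IsTiling ξ T) {p d : ℝ × ℝ} (hp : p ∈ zonogon ξ)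
    (hd : p + d ∈ zonogon ξ) :
    ∃ t ∈ T, ∃ δ : ℝ, 0 < δ ∧ p ∈ t.carrier ξ ∧ p + δ • d ∈ t.carrier ξ := by
  by_contra! hcon
  -- A closed tile not containing `p` misses all nearby points. As there are finitely many tiles,
  -- one small δ would work for all of them, and that point would be uncovered.
  have h1 : ∀ t ∈ T, ∀ᶠ δ in nhdsWithin (0 : ℝ) (Set.Ioi 0), p + δ • d ∉ t.carrier ξ := by
    intro t ht
    by_cases hpt : p ∈ t.carrier ξ
    · filter_upwards [self_mem_nhdsWithin] with δ hδ
      exact hcon t ht δ hδ hpt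
    · have hc : Filter.Tendsto (fun δ : ℝ => p + δ • d) (nhdsWithin 0 (Set.Ioi 0)) (nhds p) := by
        have : Continuous (fun δ : ℝ => p + δ • d) := by fun_prop
        have h0 := (this.tendsto 0).mono_left (nhdsWithin_le_nhds (s := Set.Ioi 0))
        simpa using h0
      exact hc.eventually (t.isClosed_carrier.isOpen_compl.mem_nhds hpt)
  have h2 := (Filter.eventually_all_finset T).mpr h1
  have h3 : ∀ᶠ δ in nhdsWithin (0 : ℝ) (Set.Ioi 0), δ ≤ 1 :=
    nhdsWithin_le_nhds (eventually_le_nhds one_pos)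
  obtain ⟨δ, ⟨hδ2, hδ1⟩, hδ0⟩ := ((h2.and h3).and self_mem_nhdsWithin).exists
  have hz : p + δ • d ∈ zonogon ξ := by
    have := convex_zonogon (ξ := ξ) hp hd (sub_nonneg.mpr hδ1) (le_of_lt hδ0) (by ring)
    convert this using 1
    module
  rw [← hT.cover, Set.mem_iUnion₂] at hz
  obtain ⟨t, ht, hz⟩ := hz
  exact hδ2 t ht hz

/-- The point lies on the right boundary of the zonogon. -/
def OnRight (ξ : ZonogonVectors n) (p : ℝ × ℝ) : Prop :=
  ∀ x > 0, p + (x, 0) ∉ zonogon ξ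

theorem onRight_zero : OnRight ξ 0 := by
  intro x hx h
  have := congrArg Prod.fst (eq_zero_of_mem_zonogon h (by simp))
  simp at this
  exact hx.ne' this

theorem onRight_top : OnRight ξ (sumVec ξ Finset.univ) := by
  intro x hx h
  have := congrArg Prod.fst (eq_top_of_mem_zonogon h (by simp))
  simp at this
  exact hx.ne' this

theorem IsTiling.not_onRight_leftCorner (hT : IsTiling ξ T) {t : Tile n} (ht : t ∈ T) :
    ¬ OnRight ξ (t.leftCorner ξ) := by
  intro h
  obtain ⟨w, hw, hw'⟩ := t.exists_leftCorner_add_mem (ξ := ξ)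
  exact h w hw (hT.carrier_subset ht (hw' w hw.le le_rfl))

theorem segment_eq_of_snd_eq {e : (ℝ × ℝ) × Fin n} {p q : ℝ × ℝ} (hp : p ∈ edgeSegment ξ e)
    (hq : q ∈ edgeSegment ξ e) (h : p.2 = q.2) : p = q := by
  rw [edgeSegment, segment_eq_image'] at hp hq
  obtain ⟨a, ha, rfl⟩ := hp
  obtain ⟨b, hb, rfl⟩ := hq
  have hu := ξ.upper e.2
  simp only [add_sub_cancel_left, Prod.snd_add, Prod.smul_snd, smul_eq_mul] at h
  have : a = b := mul_right_cancel₀ hu.ne' (add_left_cancel h)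
  rw [this]

/-- Both tiles contain a horizontal segment starting at the corner, whereas distinct tiles share at
most a point or an edge, and edges are not horizontal. -/
theorem IsTiling.eq_of_leftCorner_eq (hT : IsTiling ξ T) {s t : Tile n} (hs : s ∈ T) (ht : t ∈ T)
    (h : s.leftCorner ξ = t.leftCorner ξ) : s = t := by
  by_contra hne
  obtain ⟨v, hv, hv'⟩ := s.exists_leftCorner_add_mem (ξ := ξ)
  obtain ⟨w, hw, hw'⟩ := t.exists_leftCorner_add_mem (ξ := ξ)
  rw [h] at hv'
  set p := t.leftCorner ξ
  have hm : 0 < min v w := lt_min hv hw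
  have h0 : p + ((0 : ℝ), (0 : ℝ)) ∈ s.carrier ξ ∩ t.carrier ξ :=
    ⟨hv' 0 le_rfl hv.le, hw' 0 le_rfl hw.le⟩
  have h1 : p + (min v w, 0) ∈ s.carrier ξ ∩ t.carrier ξ :=
    ⟨hv' _ hm.le (min_le_left _ _), hw' _ hm.le (min_le_right _ _)⟩
  have key : p + ((0 : ℝ), (0 : ℝ)) = p + (min v w, 0) := by
    rcases hT.inter s hs t ht hne ⟨_, h0⟩ with ⟨q, -, hq⟩ | ⟨e, -, he⟩
    · rw [hq] at h0 h1
      exact h0.trans h1.symm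
    · rw [he] at h0 h1
      exact segment_eq_of_snd_eq h0 h1 (by simp)
  have := congrArg Prod.fst key
  simp at this
  exact hm.ne' this

theorem Tile.mem_edges_iff {t : Tile n} {e : (ℝ × ℝ) × Fin n} : e ∈ t.edges ξ ↔
    ∃ x : ℝ, (x = 0 ∨ x = 1) ∧ (e = (t.base + x • ξ.vec t.j, t.i) ∨
      e = (t.base + x • ξ.vec t.i, t.j)) := by
  constructor
  · intro he
    simp only [edges, Set.mem_insert_iff, Set.mem_singleton_iff] at he
    rcases he with rfl | rfl | rfl | rfl
    · exact ⟨0, by simp⟩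
    · exact ⟨1, by simp⟩
    · exact ⟨0, by simp⟩
    · exact ⟨1, by simp⟩
  · rintro ⟨x, rfl | rfl, rfl | rfl⟩ <;> simp [edges]

/-- In tile coordinates the midpoint has one entry 1/2, which determines the colour of the edge, and
one entry in {0, 1}, which determines the side. -/
theorem Tile.eq_of_midpoint_mem {t : Tile n} {e e' : (ℝ × ℝ) × Fin n} (he : e ∈ t.edges ξ)
    (he' : e' ∈ t.edges ξ) (h : e.1 + (1 / 2 : ℝ) • ξ.vec e.2 ∈ edgeSegment ξ e') : e = e' := by
  rw [edgeSegment, segment_eq_image'] at h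
  obtain ⟨u, -, h⟩ := h
  simp only [add_sub_cancel_left] at h
  have c0 : ∀ {a b a' b' : ℝ}, t.base + a • ξ.vec t.i + b • ξ.vec t.j =
    t.base + a' • ξ.vec t.i + b' • ξ.vec t.j → a = a' ∧ b = b' := fun h => Tile.coord_inj h
  obtain ⟨x, hx, rfl | rfl⟩ := mem_edges_iff.mp he <;>
    obtain ⟨y, hy, rfl | rfl⟩ := mem_edges_iff.mp he'
  · have := @c0 u y (1 / 2) x (by linear_combination (norm := module) h)
    rw [this.2]
  · have := @c0 y u (1 / 2) x (by linear_combination (norm := module) h)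
    exfalso
    rcases hy with rfl | rfl <;> norm_num at this
  · have := @c0 u y x (1 / 2) (by linear_combination (norm := module) h)
    exfalso
    rcases hy with rfl | rfl <;> norm_num at this
  · have := @c0 y u x (1 / 2) (by linear_combination (norm := module) h)
    rw [this.1]

/-- Each vertex lies on an edge of either colour, so an edge whose midpoint is a vertex would have
both colours of the tile. -/
theorem Tile.midpoint_notMem_vertices {t : Tile n} {e : (ℝ × ℝ) × Fin n} (he : e ∈ t.edges ξ) :
    e.1 + (1 / 2 : ℝ) • ξ.vec e.2 ∉ t.vertices ξ := by
  intro h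
  have hmem : ∀ q ∈ t.vertices ξ, (q ∈ edgeSegment ξ (t.base, t.i)) ∨
      (q ∈ edgeSegment ξ (t.base + ξ.vec t.j, t.i)) := by
    intro q hq
    simp only [vertices, Set.mem_insert_iff, Set.mem_singleton_iff] at hq
    rcases hq with rfl | rfl | rfl | rfl
    · exact Or.inl (left_mem_segment _ _ _)
    · exact Or.inl (right_mem_segment _ _ _)
    · exact Or.inr (left_mem_segment _ _ _)
    · exact Or.inr (by rw [add_right_comm]; exact right_mem_segment _ _ _)
  have hmem' : ∀ q ∈ t.vertices ξ, (q ∈ edgeSegment ξ (t.base, t.j)) ∨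
      (q ∈ edgeSegment ξ (t.base + ξ.vec t.i, t.j)) := by
    intro q hq
    simp only [vertices, Set.mem_insert_iff, Set.mem_singleton_iff] at hq
    rcases hq with rfl | rfl | rfl | rfl
    · exact Or.inl (left_mem_segment _ _ _)
    · exact Or.inr (left_mem_segment _ _ _)
    · exact Or.inl (right_mem_segment _ _ _)
    · exact Or.inr (right_mem_segment _ _ _)
  have h1 : e.2 = t.i := by
    rcases hmem _ h with h | h
    · rw [eq_of_midpoint_mem he (by simp [edges]) h]
    · rw [eq_of_midpoint_mem he (by simp [edges]) h]
  have h2 : e.2 = t.j := by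
    rcases hmem' _ h with h | h
    · rw [eq_of_midpoint_mem he (by simp [edges]) h]
    · rw [eq_of_midpoint_mem he (by simp [edges]) h]
  exact t.lt.ne (h1.symm.trans h2)

/-- An edge which does not lie on the right boundary is a left edge of some tile. -/
theorem IsTiling.exists_left_edge (hT : IsTiling ξ T) {e : (ℝ × ℝ) × Fin n}
    (he : e ∈ graphEdges ξ T) (h : ¬ OnRight ξ e.1 ∨ ¬ OnRight ξ (e.1 + ξ.vec e.2)) :
    ∃ t ∈ T, e = (t.base, t.i) ∨ e = (t.leftCorner ξ, t.j) := by
  have hz := mem_zonogon_of_mem_graphEdges (fun t => hT.carrier_subset) he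
  obtain ⟨s, hs, hes⟩ := mem_graphEdges.mp he
  set m := e.1 + (1 / 2 : ℝ) • ξ.vec e.2 with hm
  have hms : m ∈ s.carrier ξ := by
    have hv := Tile.mem_vertices_of_mem_edges hes
    have := s.convex_carrier (Tile.vertices_subset_carrier hv.1)
      (Tile.vertices_subset_carrier hv.2) (show (0 : ℝ) ≤ 1 / 2 by norm_num)
      (show (0 : ℝ) ≤ 1 / 2 by norm_num) (by norm_num)
    convert this using 1
    rw [hm]; module
  -- Moving one end to the right and averaging with the other end moves the midpoint to the right by
  -- half as much.
  obtain ⟨x, hx, hmx⟩ : ∃ x > 0, m + (x, 0) ∈ zonogon ξ := by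
    have comb : ∀ p ∈ zonogon ξ, ∀ q ∈ zonogon ξ, (1 / 2 : ℝ) • p + (1 / 2 : ℝ) • q ∈ zonogon ξ :=
      fun p hp q hq => convex_zonogon hp hq (by norm_num) (by norm_num) (by norm_num)
    have half : ∀ x : ℝ, (x / 2, (0 : ℝ)) = (1 / 2 : ℝ) • (x, (0 : ℝ)) := by
      intro x; ext <;> simp; ring
    simp only [OnRight, not_forall, not_not] at h
    rcases h with ⟨x, hx, h⟩ | ⟨x, hx, h⟩
    · refine ⟨x / 2, half_pos hx, ?_⟩
      convert comb _ h _ hz.2 using 1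
      rw [hm, half]; module
    · refine ⟨x / 2, half_pos hx, ?_⟩
      convert comb _ hz.1 _ h using 1
      rw [hm, half]; module
  obtain ⟨t, ht, δ, hδ, hmt, hmδ⟩ := hT.exists_tile (hT.carrier_subset hs hms) hmx
  -- Since `s` and `t` meet at the midpoint of `e`, which is no vertex of `s`, they share an edge
  -- through it, and that edge is `e`.
  have het : e ∈ t.edges ξ := by
    by_cases hst : s = t
    · exact hst ▸ hes
    · rcases hT.inter s hs t ht hst ⟨m, hms, hmt⟩ with ⟨q, hq, hq'⟩ | ⟨e', he', hq'⟩
      · have hmq : m ∈ s.carrier ξ ∩ t.carrier ξ := ⟨hms, hmt⟩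
        rw [hq', Set.mem_singleton_iff] at hmq
        rw [← hmq] at hq
        exact absurd hq.1 (Tile.midpoint_notMem_vertices hes)
      · have : m ∈ s.carrier ξ ∩ t.carrier ξ := ⟨hms, hmt⟩
        rw [hq'] at this
        rw [Tile.eq_of_midpoint_mem hes he'.1 this]
        exact he'.2
  refine ⟨t, ht, ?_⟩
  have hy : 0 < δ * x := mul_pos hδ hx
  have hD := ξ.clockwise t.i t.j t.lt
  have hi := ξ.upper t.i
  have hj := ξ.upper t.j
  obtain ⟨a, b, ⟨ha0, ha1⟩, ⟨hb0, hb1⟩, hab⟩ := hmδ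
  have h1 := congrArg Prod.fst hab
  have h2 := congrArg Prod.snd hab
  simp only [Tile.edges, Set.mem_insert_iff, Set.mem_singleton_iff] at het
  -- On a right edge of `t`, moving right from the midpoint would leave the tile; only the two left
  -- edges remain.
  rcases het with het | het | het | het
  · exact Or.inl het
  · exfalso
    rw [hm, het] at h1 h2
    simp at h1 h2
    have : (b - 1) * -((ξ.vec t.i).1 * (ξ.vec t.j).2 - (ξ.vec t.i).2 * (ξ.vec t.j).1) =
        δ * x * (ξ.vec t.i).2 := by
      linear_combination (ξ.vec t.i).1 * h2 - (ξ.vec t.i).2 * h1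
    nlinarith [mul_pos hy hi]
  · exfalso
    rw [hm, het] at h1 h2
    simp at h1 h2
    have : a * ((ξ.vec t.i).1 * (ξ.vec t.j).2 - (ξ.vec t.i).2 * (ξ.vec t.j).1) =
        δ * x * (ξ.vec t.j).2 := by
      linear_combination (ξ.vec t.j).1 * h2 - (ξ.vec t.j).2 * h1
    nlinarith [mul_pos hy hj]
  · exact Or.inr het

theorem exists_ascent (hω : σ ≠ omega n) :
    ∃ (k : ℕ) (hk : k + 1 < n), σ ⟨k, by omega⟩ < σ ⟨k + 1, hk⟩ := by
  by_contra! hcon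
  apply hω
  have hanti : ∀ a b : Fin n, a < b → σ b < σ a := by
    intro a
    have key : ∀ d : ℕ, ∀ b : Fin n, (b : ℕ) = a + d + 1 → σ b < σ a := by
      intro d
      induction d with
      | zero =>
        intro b hb
        have hb' : b = ⟨a + 1, by omega⟩ := Fin.ext (by simpa using hb)
        have h1 := hcon a (by omega)
        rw [hb']
        exact lt_of_le_of_ne h1 fun h => by simpa [Fin.ext_iff] using σ.injective h
      | succ d ih =>
        intro b hb
        have hb' : b = ⟨a + d + 1 + 1, by omega⟩ := Fin.ext (by simp; omega)
        have h1 := hcon (a + d + 1) (by omega)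
        rw [hb']
        exact lt_of_le_of_lt h1 (ih ⟨a + d + 1, by omega⟩ rfl)
    intro b hab
    exact key (b - a - 1) b (by have := Fin.lt_def.mp hab; omega)
  apply LinOrd.ext_less
  intro i j hij
  have := hanti _ _ hij
  rw [omega_less]
  simpa using this

/-- A path in a tiling that is not the rightmost one passes along the two left edges of a tile. -/
theorem IsTiling.exists_flip (hT : IsTiling ξ T) (h : EdgesIn ξ T σ) (hω : σ ≠ omega n) :
    ∃ τ, EdgesIn ξ T τ ∧ ∃ i j, IsFlip σ τ i j := by
  by_contra hcon
  -- Under the contrary assumption, no tile has two consecutive edges of the path as its left edges.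
  have noflip : ∀ k (hk : k + 1 < n), ∀ t ∈ T,
      (sumVec ξ (prefixSet σ k), σ ⟨k, by omega⟩) = (t.base, t.i) →
      t.j ≠ σ ⟨k + 1, hk⟩ := by
    intro k hk t ht h1 h2
    rw [Prod.mk.injEq] at h1
    apply hcon
    have hadj : (σ.symm t.j : ℕ) = σ.symm t.i + 1 := by
      rw [h2, ← h1.2]; simp
    have hf := isFlip_of_adjacent t.lt hadj
    refine ⟨_, h.of_isFlip hf ?_, _, _, hf⟩
    have : sumVec ξ (before σ t.i) = t.base := by
      rw [← h1.2, before_apply]; exact h1.1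
    simpa [this] using ht
  have hedge : ∀ k (hk : k < n), (sumVec ξ (prefixSet σ k), σ ⟨k, hk⟩) ∈ graphEdges ξ T := by
    intro k hk
    have := h (σ ⟨k, hk⟩)
    rwa [before_apply] at this
  have hsucc : ∀ k (hk : k < n), sumVec ξ (prefixSet σ (k + 1)) =
      sumVec ξ (prefixSet σ k) + ξ.vec (σ ⟨k, hk⟩) := fun k hk =>
    sumVec_prefixSet_succ (ξ := ξ) (σ := σ) ⟨k, hk⟩
  -- an edge whose upper end is not on the right boundary is the lower left edge of a tile
  have lower : ∀ k (hk : k < n), ¬ OnRight ξ (sumVec ξ (prefixSet σ (k + 1))) →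
      ∃ t ∈ T, (sumVec ξ (prefixSet σ k), σ ⟨k, hk⟩) = (t.base, t.i) := by
    intro k
    induction k with
    | zero =>
      intro hk h1
      obtain ⟨t, ht, h2 | h2⟩ := hT.exists_left_edge (hedge 0 hk) (Or.inr (hsucc 0 hk ▸ h1))
      · exact ⟨t, ht, h2⟩
      · rw [Prod.mk.injEq] at h2
        exact absurd (h2.1 ▸ (by simpa [prefixSet_zero, sumVec] using onRight_zero))
          (hT.not_onRight_leftCorner ht)
    | succ k ih =>
      intro hk h1
      obtain ⟨t, ht, h2 | h2⟩ :=
        hT.exists_left_edge (hedge (k + 1) hk) (Or.inr (hsucc (k + 1) hk ▸ h1))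
      · exact ⟨t, ht, h2⟩
      · exfalso
        rw [Prod.mk.injEq] at h2
        obtain ⟨s, hs, h3⟩ := ih (by omega) (h2.1 ▸ hT.not_onRight_leftCorner ht)
        have hst : s = t := by
          apply hT.eq_of_leftCorner_eq hs ht
          rw [← h2.1, hsucc k (by omega)]
          rw [Prod.mk.injEq] at h3
          rw [Tile.leftCorner, ← h3.1, ← h3.2]
        exact noflip k hk s hs h3 (hst ▸ h2.2.symm)
  obtain ⟨k, hk, hasc⟩ := exists_ascent hω
  -- At an ascent, the vertex is the left corner of a rhombus inside the zonogon; this rhombus need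
  -- not belong to `T`.
  have hk1 : ¬ OnRight ξ (sumVec ξ (prefixSet σ (k + 1))) := by
    obtain ⟨w, hw, hw'⟩ := (Tile.mk (sumVec ξ (prefixSet σ k)) _ _ hasc).exists_leftCorner_add_mem
      (ξ := ξ)
    intro hr
    refine hr w hw ?_
    have hm := hw' w hw.le le_rfl
    rw [hsucc k (by omega)]
    exact sumVec_mem_zonogon_aux (by simp [mem_prefixSet]) (by simp [mem_prefixSet]) hasc hm
  -- From there upward every edge is again the lower left edge of a tile, so its upper end is off
  -- the right boundary too. At the top of the zonogon this is absurd.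
  have upper : ∀ l, k + 1 ≤ l → l ≤ n → ¬ OnRight ξ (sumVec ξ (prefixSet σ l)) := by
    intro l hl
    induction l, hl using Nat.le_induction with
    | base => exact fun _ => hk1
    | succ l hl ih =>
      intro hln
      have ih := ih (by omega)
      obtain ⟨t, ht, h2 | h2⟩ := hT.exists_left_edge (hedge l (by omega)) (Or.inl ih)
      · rw [hsucc l (by omega)]
        rw [Prod.mk.injEq] at h2
        rw [h2.1, h2.2]
        exact hT.not_onRight_leftCorner ht
      · exfalso
        obtain ⟨l, rfl⟩ : ∃ l', l = l' + 1 := ⟨l - 1, by omega⟩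
        rw [Prod.mk.injEq] at h2
        obtain ⟨s, hs, h3⟩ := lower l (by omega) ih
        have hst : s = t := by
          apply hT.eq_of_leftCorner_eq hs ht
          rw [← h2.1, hsucc l (by omega)]
          rw [Prod.mk.injEq] at h3
          rw [Tile.leftCorner, ← h3.1, ← h3.2]
        exact noflip l (by omega) s hs h3 (hst ▸ h2.2.symm)
  have := upper n (by omega) le_rfl
  rw [prefixSet_self] at this
  exact this onRight_top

/-! ### Supporting lines and the left boundary path -/

/-- The determinant with the vector of colour `c`. -/
def detVec (ξ : ZonogonVectors n) (c : Fin n) : (ℝ × ℝ) →ₗ[ℝ] ℝ :=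
  (ξ.vec c).2 • LinearMap.fst ℝ ℝ ℝ - (ξ.vec c).1 • LinearMap.snd ℝ ℝ ℝ

theorem detVec_apply (c : Fin n) (p : ℝ × ℝ) :
    detVec ξ c p = (ξ.vec c).2 * p.1 - (ξ.vec c).1 * p.2 := rfl

theorem detVec_self (c : Fin n) : detVec ξ c (ξ.vec c) = 0 := by
  rw [detVec_apply]; ring

theorem detVec_neg {i c : Fin n} (h : i < c) : detVec ξ c (ξ.vec i) < 0 := by
  rw [detVec_apply]; linarith [ξ.clockwise i c h]

theorem detVec_pos {i c : Fin n} (h : c < i) : 0 < detVec ξ c (ξ.vec i) := by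
  rw [detVec_apply]; linarith [ξ.clockwise c i h]

/-- The functional is negative on colours below `c`, zero on `c` and positive above. It is thus
minimal exactly when the coefficients are 1 below `c` and 0 above, with that of `c` free. -/
theorem detVec_alpha_le {c : Fin n} {p : ℝ × ℝ} (hp : p ∈ zonogon ξ) :
    detVec ξ c (sumVec ξ (before (alpha n) c)) ≤ detVec ξ c p ∧
    (detVec ξ c p = detVec ξ c (sumVec ξ (before (alpha n) c)) →
      ∃ u ≥ (0 : ℝ), p = sumVec ξ (before (alpha n) c) + u • ξ.vec c) := by
  obtain ⟨a, ha, rfl⟩ := hp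
  have hb : sumVec ξ (before (alpha n) c) =
      ∑ i, (if i < c then (1 : ℝ) else 0) • ξ.vec i := by
    simp only [ite_smul, one_smul, zero_smul]
    rw [← Finset.sum_filter, sumVec]
    congr 1
  have hterm : ∀ i ∈ Finset.univ, (if i < c then (1 : ℝ) else 0) * detVec ξ c (ξ.vec i) ≤
      a i * detVec ξ c (ξ.vec i) := by
    intro i _
    rcases lt_trichotomy i c with h | h | h
    · simp only [h, if_true]
      exact mul_le_mul_of_nonpos_right (ha i).2 (detVec_neg h).le
    · subst h; simp [detVec_self]
    · simp only [h.not_gt, if_false, zero_mul]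
      exact mul_nonneg (ha i).1 (detVec_pos h).le
  rw [hb]
  simp only [map_sum, map_smul, smul_eq_mul]
  refine ⟨Finset.sum_le_sum hterm, fun he => ⟨a c, (ha c).1, ?_⟩⟩
  have hall := (Finset.sum_eq_sum_iff_of_le hterm).mp he.symm
  have hone : a c • ξ.vec c = ∑ i, (if i = c then a c else 0) • ξ.vec i := by simp [ite_smul]
  rw [hone, ← Finset.sum_add_distrib]
  refine Finset.sum_congr rfl fun i hi => ?_
  rw [← add_smul]
  congr 1
  rcases lt_trichotomy i c with h | h | h
  · simpa [h, h.ne] using (mul_right_cancel₀ (detVec_neg h).ne (hall i hi)).symm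
  · subst h; simp
  · simpa [h.not_gt, h.ne'] using (mul_right_cancel₀ (detVec_pos h).ne' (hall i hi)).symm

/-- Some tile contains the start of the boundary edge, where the functional of `c` is minimal on the
zonogon. If `c` is a colour of the tile, minimality puts the point on the left edge of that colour,
and comparing heights identifies its lower end with `V`. -/
theorem IsTiling.edgesIn_alpha (hT : IsTiling ξ T) : EdgesIn ξ T (alpha n) := by
  intro c
  have hnm : c ∉ before (alpha n) c := notMem_before _ _
  set V := sumVec ξ (before (alpha n) c) with hV
  have hVz : V ∈ zonogon ξ := sumVec_mem_zonogon _
  have hVc : V + ξ.vec c ∈ zonogon ξ := by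
    rw [hV, ← sumVec_insert hnm]; exact sumVec_mem_zonogon _
  obtain ⟨t, ht, δ, hδ, ⟨a, b, ha, hb, h1⟩, ⟨a', b', ha', hb', h2⟩⟩ := hT.exists_tile hVz hVc
  have corner : ∀ x y : ℝ, 0 ≤ x → x ≤ 1 → 0 ≤ y → y ≤ 1 →
      t.base + x • ξ.vec t.i + y • ξ.vec t.j ∈ zonogon ξ := fun x y h0 h1 h2 h3 =>
    hT.carrier_subset ht ⟨x, y, ⟨h0, h1⟩, ⟨h2, h3⟩, rfl⟩
  have hle := fun x y h0 h1 h2 h3 => (detVec_alpha_le (c := c) (corner x y h0 h1 h2 h3)).1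
  have e1 := congrArg (detVec ξ c) h1
  have e2 := congrArg (detVec ξ c) h2
  rw [← hV] at hle
  have hcpos := ξ.upper c
  simp only [map_add, map_smul, smul_eq_mul, detVec_self, mul_zero, add_zero] at e1 e2 hle
  refine mem_graphEdges.mpr ⟨t, ht, ?_⟩
  by_cases hci : c = t.i
  · have hj : 0 < detVec ξ c (ξ.vec t.j) := detVec_pos (hci ▸ t.lt)
    have hi : detVec ξ c (ξ.vec t.i) = 0 := hci ▸ detVec_self c
    have q := hle a 0 ha.1 ha.2 le_rfl zero_le_one
    have hb0 : b = 0 := by nlinarith [hb.1]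
    have q0 := corner 0 0 le_rfl zero_le_one le_rfl zero_le_one
    obtain ⟨u, hu, hu'⟩ := (detVec_alpha_le (c := c) q0).2 (by
      rw [← hV]
      simp only [map_add, map_smul, smul_eq_mul]
      rw [e1, hb0, hi]; ring)
    rw [← hV] at hu'
    have e3 := congrArg Prod.snd hu'
    have e4 := congrArg Prod.snd h1
    rw [hb0, ← hci] at e4
    simp at e3 e4
    have : u = 0 := by nlinarith [ha.1]
    rw [this] at hu'
    simp at hu'
    rw [hci, ← hu']; simp [Tile.edges]
  · by_cases hcj : c = t.j
    · have hi : detVec ξ c (ξ.vec t.i) < 0 := detVec_neg (hcj ▸ t.lt)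
      have hj : detVec ξ c (ξ.vec t.j) = 0 := hcj ▸ detVec_self c
      have q := hle 1 b zero_le_one le_rfl hb.1 hb.2
      have ha1 : a = 1 := by nlinarith [ha.2]
      have q0 := corner 1 0 zero_le_one le_rfl le_rfl zero_le_one
      obtain ⟨u, hu, hu'⟩ := (detVec_alpha_le (c := c) q0).2 (by
        rw [← hV]
        simp only [map_add, map_smul, smul_eq_mul]
        rw [e1, ha1, hj]; ring)
      rw [← hV] at hu'
      have e3 := congrArg Prod.snd hu'
      have e4 := congrArg Prod.snd h1
      rw [ha1, ← hcj] at e4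
      simp at e3 e4
      have : u = 0 := by nlinarith [hb.1]
      rw [this] at hu'
      simp at hu'
      rw [hcj, ← hu']; simp [Tile.edges]
    · exfalso
      -- If `c` is not a colour of the tile, both coordinates have nonzero weight, so the minimum is
      -- attained at one point of the tile at most, but two distinct points were found.
      have key : ∀ {x y x' y' : ℝ}, 0 ≤ x → x ≤ 1 → 0 ≤ y → y ≤ 1 → 0 ≤ x' → x' ≤ 1 → 0 ≤ y' →
          y' ≤ 1 →
          detVec ξ c V = detVec ξ c t.base + x * detVec ξ c (ξ.vec t.i) +
            y * detVec ξ c (ξ.vec t.j) →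
          detVec ξ c V = detVec ξ c t.base + x' * detVec ξ c (ξ.vec t.i) +
            y' * detVec ξ c (ξ.vec t.j) → x ≤ x' ∧ y ≤ y' := by
        intro x y x' y' hx0 hx1 hy0 hy1 hx0' hx1' hy0' hy1' h h'
        constructor
        · rcases lt_or_gt_of_ne hci with hlt | hlt
          · have := hle 0 y le_rfl zero_le_one hy0 hy1
            nlinarith [detVec_pos (ξ := ξ) hlt]
          · have := hle 1 y' zero_le_one le_rfl hy0' hy1'
            nlinarith [detVec_neg (ξ := ξ) hlt]
        · rcases lt_or_gt_of_ne hcj with hlt | hlt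
          · have := hle x 0 hx0 hx1 le_rfl zero_le_one
            nlinarith [detVec_pos (ξ := ξ) hlt]
          · have := hle x' 1 hx0' hx1' zero_le_one le_rfl
            nlinarith [detVec_neg (ξ := ξ) hlt]
      have k1 := key ha.1 ha.2 hb.1 hb.2 ha'.1 ha'.2 hb'.1 hb'.2 e1 e2
      have k2 := key ha'.1 ha'.2 hb'.1 hb'.2 ha.1 ha.2 hb.1 hb.2 e2 e1
      rw [le_antisymm k1.1 k2.1, le_antisymm k1.2 k2.2, ← h2] at h1
      have := congrArg Prod.snd h1
      simp at this
      rcases this with h | h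
      · exact hδ.ne' h
      · exact hcpos.ne' h

theorem IsTilingType.isSemiConnected (hn : 0 < n) {D : Set (LinOrd n)} (h : IsTilingType ξ D) :
    IsSemiConnected D := by
  obtain ⟨T, hT, rfl⟩ := h
  obtain ⟨p, hp, hp'⟩ := isSemiConnected_of_step (D := {σ | EdgesIn ξ T σ}) hT.edgesIn_alpha
    fun σ hσ hω => hT.exists_flip hσ hω
  exact ⟨p, hp, fun σ hσ =>
    EdgesIn.mem_snakeOrders hn (fun t => hT.carrier_subset) (hp' σ hσ)⟩

end CondorcetTiling

namespace CondorcetTiling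

variable {n : ℕ}

/-! ### Maximal peak-pit domains contain chains of flips -/

/-- The two conditions say that inverting exactly the pairs in `P` gives a transitive relation. The
position of an alternative is then the number of its predecessors. -/
theorem exists_linOrd_of_flags (P : Fin n → Fin n → Prop)
    (h1 : ∀ i j k, i < j → j < k → P i j → P j k → P i k)
    (h2 : ∀ i j k, i < j → j < k → P i k → P i j ∨ P j k) :
    ∃ σ : LinOrd n, ∀ i j, i < j → (σ.Less j i ↔ P i j) := by
  classical
  let r : Fin n → Fin n → Prop := fun a b => (a < b ∧ ¬ P a b) ∨ (b < a ∧ P b a)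
  have irr : ∀ a, ¬ r a a := fun a h => by rcases h with h | h <;> exact lt_irrefl _ h.1
  have tot : ∀ a b, a ≠ b → r a b ∨ r b a := by
    intro a b hab
    rcases lt_or_gt_of_ne hab with h | h
    · by_cases hp : P a b
      · exact Or.inr (Or.inr ⟨h, hp⟩)
      · exact Or.inl (Or.inl ⟨h, hp⟩)
    · by_cases hp : P b a
      · exact Or.inl (Or.inr ⟨h, hp⟩)
      · exact Or.inr (Or.inl ⟨h, hp⟩)
  have tr : ∀ a b c, r a b → r b c → r a c := by
    rintro a b c (⟨hab, p⟩ | ⟨hab, p⟩) (⟨hbc, q⟩ | ⟨hbc, q⟩)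
    · exact Or.inl ⟨hab.trans hbc, fun h => (h2 a b c hab hbc h).elim p q⟩
    · rcases lt_trichotomy a c with h | h | h
      · exact Or.inl ⟨h, fun h' => p (h1 a c b h hbc h' q)⟩
      · subst h; exact absurd q p
      · exact Or.inr ⟨h, (h2 c a b h hab q).resolve_right p⟩
    · rcases lt_trichotomy a c with h | h | h
      · exact Or.inl ⟨h, fun h' => q (h1 b a c hab h p h')⟩
      · subst h; exact absurd p q
      · exact Or.inr ⟨h, (h2 b c a hbc h p).resolve_left q⟩
    · exact Or.inr ⟨hbc.trans hab, h1 c b a hbc hab q p⟩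
  let rank : Fin n → ℕ := fun a => (Finset.univ.filter fun x => r x a).card
  have mono : ∀ a b, r a b → rank a < rank b := by
    intro a b hab
    apply Finset.card_lt_card
    refine ⟨fun x hx => ?_, fun hsub => ?_⟩
    · simp only [Finset.mem_filter, Finset.mem_univ, true_and] at hx ⊢
      exact tr x a b hx hab
    · have := hsub (show a ∈ _ by simpa using hab)
      simp only [Finset.mem_filter, Finset.mem_univ, true_and] at this
      exact irr a this
  have lt : ∀ a, rank a < n := by
    intro a
    have : rank a < (Finset.univ : Finset (Fin n)).card := by
      apply Finset.card_lt_card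
      refine ⟨Finset.subset_univ _, fun hsub => ?_⟩
      have := hsub (Finset.mem_univ a)
      simp only [Finset.mem_filter, Finset.mem_univ, true_and] at this
      exact irr a this
    simpa using this
  let f : Fin n → Fin n := fun a => ⟨rank a, lt a⟩
  have inj : Function.Injective f := by
    intro a b hab
    by_contra hne
    have hab' : rank a = rank b := congrArg Fin.val hab
    rcases tot a b hne with h | h
    · exact (mono _ _ h).ne hab'
    · exact (mono _ _ h).ne' hab'
  let e : Equiv.Perm (Fin n) := Equiv.ofBijective f (Finite.injective_iff_bijective.mp inj)
  have key : ∀ a b, r a b → e a < e b := fun a b h => mono a b h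
  refine ⟨e.symm, fun i j hij => ?_⟩
  simp only [LinOrd.Less, Equiv.symm_symm]
  constructor
  · intro h
    by_contra hp
    exact (key i j (Or.inl ⟨hij, hp⟩)).asymm h
  · intro h
    exact key j i (Or.inr ⟨hij, h⟩)

theorem IsPeakPit.insert_iff {D : Set (LinOrd n)} {σ : LinOrd n} :
    IsPeakPit (insert σ D) ↔ ∀ i j k : Fin n, i < j → j < k →
      (InPeak σ i j k ∧ ∀ τ ∈ D, InPeak τ i j k) ∨ (InPit σ i j k ∧ ∀ τ ∈ D, InPit τ i j k) := by
  simp only [IsPeakPit, Set.forall_mem_insert]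

theorem IsPeakPit.insert_alpha {D : Set (LinOrd n)} (hD : IsPeakPit D) :
    IsPeakPit (insert (alpha n) D) := by
  rw [IsPeakPit.insert_iff]
  intro i j k hij hjk
  have h : RestrictsTo (alpha n) i j k := ⟨hij, hjk⟩
  exact (hD i j k hij hjk).imp (fun h' => ⟨Or.inl h, h'⟩) (fun h' => ⟨Or.inl h, h'⟩)

theorem IsPeakPit.insert_omega {D : Set (LinOrd n)} (hD : IsPeakPit D) :
    IsPeakPit (insert (omega n) D) := by
  rw [IsPeakPit.insert_iff]
  intro i j k hij hjk
  have h : RestrictsTo (omega n) k j i := ⟨omega_less.mpr hjk, omega_less.mpr hij⟩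
  exact (hD i j k hij hjk).imp (fun h' => ⟨Or.inr (Or.inr (Or.inr h)), h'⟩)
    (fun h' => ⟨Or.inr (Or.inr (Or.inr h)), h'⟩)

/-- The inversion sets of a maximal peak-pit domain form a distributive lattice. -/
theorem exists_Inv_eq_union_inter {D : Set (LinOrd n)} (hD : IsPeakPit D)
    (hmax : ∀ σ, IsPeakPit (insert σ D) → σ ∈ D) {ρ σ τ : LinOrd n} (hρ : ρ ∈ D) (hσ : σ ∈ D)
    (hτ : τ ∈ D) : ∃ π ∈ D, Inv π = (Inv ρ ∪ Inv σ) ∩ Inv τ := by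
  let P : Fin n → Fin n → Prop := fun i j => (ρ.Less j i ∨ σ.Less j i) ∧ τ.Less j i
  have hP : ∀ i j k, i < j → j < k →
      (((P i j → P i k) ∧ (P i k → P j k)) ∧ ∀ υ ∈ D, InPeak υ i j k) ∨
      (((P j k → P i k) ∧ (P i k → P i j)) ∧ ∀ υ ∈ D, InPit υ i j k) := by
    intro i j k hij hjk
    refine (hD i j k hij hjk).imp (fun h => ⟨?_, h⟩) (fun h => ⟨?_, h⟩)
    · have e1 := (inPeak_iff hij hjk).mp (h ρ hρ)
      have e2 := (inPeak_iff hij hjk).mp (h σ hσ)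
      have e3 := (inPeak_iff hij hjk).mp (h τ hτ)
      exact ⟨fun ⟨a, b⟩ => ⟨a.imp e1.1 e2.1, e3.1 b⟩, fun ⟨a, b⟩ => ⟨a.imp e1.2 e2.2, e3.2 b⟩⟩
    · have e1 := (inPit_iff hij hjk).mp (h ρ hρ)
      have e2 := (inPit_iff hij hjk).mp (h σ hσ)
      have e3 := (inPit_iff hij hjk).mp (h τ hτ)
      exact ⟨fun ⟨a, b⟩ => ⟨a.imp e1.1 e2.1, e3.1 b⟩, fun ⟨a, b⟩ => ⟨a.imp e1.2 e2.2, e3.2 b⟩⟩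
  -- Of the two implications on a triple, one supplies transitivity and the other its dual,
  -- whichever condition holds.
  obtain ⟨π, hπ⟩ := exists_linOrd_of_flags P
    (fun i j k hij hjk h h' => (hP i j k hij hjk).elim (fun q => q.1.1 h) (fun q => q.1.1 h'))
    (fun i j k hij hjk h => (hP i j k hij hjk).elim (fun q => Or.inr (q.1.2 h))
      (fun q => Or.inl (q.1.2 h)))
  refine ⟨π, hmax π ?_, ?_⟩
  · rw [IsPeakPit.insert_iff]
    intro i j k hij hjk
    rw [inPeak_iff hij hjk, inPit_iff hij hjk, hπ i j hij, hπ j k hjk, hπ i k (hij.trans hjk)]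
    exact hP i j k hij hjk
  · ext ⟨i, j⟩
    simp only [Set.mem_inter_iff, Set.mem_union, mem_Inv]
    constructor
    · rintro ⟨h, h'⟩
      have := (hπ i j h).mp h'
      exact ⟨this.1.imp (fun x => ⟨h, x⟩) (fun x => ⟨h, x⟩), h, this.2⟩
    · rintro ⟨h, h1, h2⟩
      exact ⟨h1, (hπ i j h1).mpr ⟨h.imp And.right And.right, h2⟩⟩

/-- Otherwise `τ` agrees with `σ` on all neighbours in the word `σ`, hence by transitivity
everywhere. -/
theorem exists_adjacent_inverted {σ τ : LinOrd n} (hne : σ ≠ τ) (hsub : Inv σ ⊆ Inv τ) :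
    ∃ i j, i < j ∧ (σ.symm j : ℕ) = σ.symm i + 1 ∧ τ.Less j i := by
  by_contra! hcon
  apply hne
  have step : ∀ (k : ℕ) (hk : k + 1 < n),
      τ.Less (σ ⟨k, by omega⟩) (σ ⟨k + 1, hk⟩) := by
    intro k hk
    have hne' : σ ⟨k, by omega⟩ ≠ σ ⟨k + 1, hk⟩ := by
      intro h; simpa [Fin.ext_iff] using σ.injective h
    by_contra h
    rw [LinOrd.not_less_iff _ hne'] at h
    rcases lt_or_gt_of_ne hne' with hlt | hlt
    · exact hcon _ _ hlt (by simp) h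
    · have : (σ ⟨k + 1, hk⟩, σ ⟨k, by omega⟩) ∈ Inv σ := ⟨hlt, by simp [LinOrd.Less]⟩
      exact h.asymm (hsub this).2
  have mono : ∀ (d k : ℕ) (hk : k + d + 1 < n),
      τ.Less (σ ⟨k, by omega⟩) (σ ⟨k + d + 1, hk⟩) := by
    intro d k
    induction d with
    | zero => exact fun hk => step k hk
    | succ d ih => exact fun hk => (ih (by omega)).trans (step (k + d + 1) hk)
  apply LinOrd.ext_less
  intro i j hij
  have h' : (σ.symm i : ℕ) < σ.symm j := hij
  have hlt := (σ.symm j).isLt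
  have := mono (σ.symm j - σ.symm i - 1) (σ.symm i) (by omega)
  have e : (⟨(σ.symm i : ℕ) + (σ.symm j - σ.symm i - 1) + 1, by omega⟩ : Fin n) = σ.symm j :=
    Fin.ext (by simp; omega)
  rw [e] at this
  simpa using this

/-- Take `τ` in `D` with as few inversions as possible strictly above `σ`, and flip a neighbouring
pair of `σ` that `τ` inverts. By maximality it suffices that the result is compatible with `D` on
every triple. -/
theorem exists_flip_of_maximal {D : Set (LinOrd n)} (hD : IsPeakPit D)
    (hmax : ∀ σ, IsPeakPit (insert σ D) → σ ∈ D) {σ : LinOrd n} (hσ : σ ∈ D) (hω : σ ≠ omega n) :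
    ∃ τ ∈ D, ∃ i j, IsFlip σ τ i j := by
  have hωI : ∀ ρ : LinOrd n, Inv ρ ⊆ Inv (omega n) := fun ρ p hp => ⟨hp.1, omega_less.mpr hp.1⟩
  obtain ⟨τ, ⟨hτ, hστ⟩, hmin⟩ := Set.exists_min_image {τ | τ ∈ D ∧ Inv σ ⊂ Inv τ}
    (fun τ => (Inv τ).ncard) (Set.toFinite _)
    ⟨omega n, hmax _ hD.insert_omega, (hωI σ).ssubset_of_ne fun h => hω (LinOrd.ext_Inv h)⟩
  obtain ⟨i, j, hij, hadj, hτij⟩ := exists_adjacent_inverted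
    (fun h => hστ.ne (congrArg Inv h)) hστ.subset
  have hf := isFlip_of_adjacent hij hadj
  refine ⟨_, hmax _ ?_, i, j, hf⟩
  set υ : LinOrd n := σ.trans (Equiv.swap i j)
  -- Otherwise (Inv ρ ∪ Inv σ) ∩ Inv τ would lie strictly between σ and τ: it contains the pair ab
  -- but lacks ij.
  have noblock : ∀ ρ ∈ D, ρ.Less i j → ∀ a b, a < b → ρ.Less b a → τ.Less b a →
      σ.Less a b → False := by
    intro ρ hρ hρij a b hab h1 h2 h3
    obtain ⟨π, hπ, hI⟩ := exists_Inv_eq_union_inter hD hmax hρ hσ hτ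
    have hlt : Inv σ ⊂ Inv π := by
      refine ⟨fun p hp => hI ▸ ⟨Or.inr hp, hστ.subset hp⟩, fun h => ?_⟩
      have : (a, b) ∈ Inv σ := h (hI ▸ ⟨Or.inl ⟨hab, h1⟩, hab, h2⟩)
      exact h3.asymm this.2
    have hlt' : Inv π ⊂ Inv τ := by
      refine ⟨fun p hp => (hI ▸ hp : p ∈ (Inv ρ ∪ Inv σ) ∩ Inv τ).2, fun h => ?_⟩
      have h4 : (i, j) ∈ Inv π := h ⟨hij, hτij⟩
      rw [hI] at h4
      rcases h4.1 with h5 | h5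
      · exact hρij.asymm h5.2
      · exact hf.less.asymm h5.2
    exact absurd (hmin π ⟨hπ, hlt⟩) (not_le.mpr (Set.ncard_lt_ncard hlt' (Set.toFinite _)))
  have hside : ∀ b, b ≠ i → b ≠ j → (σ.Less b i ∧ σ.Less b j ∧ υ.Less b i ∧ υ.Less b j) ∨
      (σ.Less i b ∧ σ.Less j b ∧ υ.Less i b ∧ υ.Less j b) := by
    intro b bi bj
    have l1 := hf.less_iff (a := b) (b := i) (by simp [bi]) (by simp [bj])
    have l2 := hf.less_iff (a := b) (b := j) (by simp [bi]) (by simp [bj])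
    have l3 := hf.less_iff (a := i) (b := b) (by simp [bj]) (by simp [bi])
    have l4 := hf.less_iff (a := j) (b := b) (by simp [bj]) (by simp [bi])
    rcases σ.less_or_less bi with h | h
    · have h' : σ.Less b j := h.trans hf.less
      exact Or.inl ⟨h, h', l1.mpr h, l2.mpr h'⟩
    · have h' : σ.Less j b := by
        have h1 : (σ.symm i : ℕ) < σ.symm b := h
        have h2 : (σ.symm b : ℕ) ≠ σ.symm j := fun e => bj (σ.symm.injective (Fin.ext e))
        simp only [LinOrd.Less, Fin.lt_def]
        omega
      exact Or.inr ⟨h, h', l3.mpr h, l4.mpr h'⟩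
  have hυ := hf.less_symm
  rw [IsPeakPit.insert_iff]
  intro p q r hpq hqr
  have hpr := hpq.trans hqr
  by_cases c1 : i = p ∧ j = q
  · obtain ⟨rfl, rfl⟩ := c1
    rcases hside r hpr.ne' hqr.ne' with ⟨-, -, h3, h4⟩ | ⟨-, h2, h3, h4⟩
    · exact (hD _ _ _ hpq hqr).imp
        (fun h => ⟨Or.inr (Or.inr (Or.inr ⟨h4, hυ⟩)), h⟩)
        (fun h => ⟨Or.inr (Or.inr (Or.inr ⟨h4, hυ⟩)), h⟩)
    -- The flip forces the pit condition here. If `D` is only known to be peak on this triple,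
    -- `noblock` shows that all its members satisfy the pit condition as well.
    · refine Or.inr ⟨Or.inr (Or.inl ⟨hυ, h3⟩), ?_⟩
      rcases hD _ _ _ hpq hqr with h | h
      · intro ρ hρ
        by_contra hcon
        have e1 := (inPeak_iff hpq hqr).mp (h ρ hρ)
        have e2 := (inPeak_iff hpq hqr).mp (h τ hτ)
        rw [inPit_iff hpq hqr] at hcon
        have hij' : ρ.Less i j := by
          rw [← ρ.not_less_iff hij.ne']; tauto
        exact noblock ρ hρ hij' j r hqr (by tauto) (e2.2 (e2.1 hτij)) h2
      · exact h
  by_cases c2 : i = q ∧ j = r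
  · obtain ⟨rfl, rfl⟩ := c2
    rcases hside p hpq.ne hpr.ne with ⟨h1, -, h3, h4⟩ | ⟨-, -, h3, h4⟩
    · refine Or.inl ⟨Or.inr (Or.inl ⟨h4, hυ⟩), ?_⟩
      rcases hD _ _ _ hpq hqr with h | h
      · exact h
      · intro ρ hρ
        by_contra hcon
        have e1 := (inPit_iff hpq hqr).mp (h ρ hρ)
        have e2 := (inPit_iff hpq hqr).mp (h τ hτ)
        rw [inPeak_iff hpq hqr] at hcon
        have hij' : ρ.Less i j := by
          rw [← ρ.not_less_iff hij.ne']; tauto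
        exact noblock ρ hρ hij' p i hpq (by tauto) (e2.2 (e2.1 hτij)) h1
    · exact (hD _ _ _ hpq hqr).imp
        (fun h => ⟨Or.inr (Or.inr (Or.inr ⟨hυ, h3⟩)), h⟩)
        (fun h => ⟨Or.inr (Or.inr (Or.inr ⟨hυ, h3⟩)), h⟩)
  have m1 : υ.Less q p ↔ σ.Less q p :=
    hf.less_iff (fun e => (e.1 ▸ e.2 ▸ hij).not_gt hpq) (fun e => c1 ⟨e.2.symm, e.1.symm⟩)
  have m2 : υ.Less r q ↔ σ.Less r q :=
    hf.less_iff (fun e => (e.1 ▸ e.2 ▸ hij).not_gt hqr) (fun e => c2 ⟨e.2.symm, e.1.symm⟩)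
  -- With the third alternative between i and j in value, the restriction of `σ` already excludes
  -- one of the two conditions, and the flip satisfies the other.
  by_cases c3 : i = p ∧ j = r
  · obtain ⟨rfl, rfl⟩ := c3
    rw [inPeak_iff hpq hqr, inPit_iff hpq hqr, m1, m2]
    have hr : ¬ σ.Less j i := hf.less.asymm
    rcases hside q hpq.ne' hqr.ne with ⟨h1, h2, -⟩ | ⟨h1, h2, -⟩
    · refine Or.inr ⟨⟨fun _ => hυ, fun _ => h1⟩, (hD _ _ _ hpq hqr).resolve_left fun h => ?_⟩
      exact hr (((inPeak_iff hpq hqr).mp (h σ hσ)).1 h1)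
    · refine Or.inl ⟨⟨fun _ => hυ, fun _ => h2⟩, (hD _ _ _ hpq hqr).resolve_right fun h => ?_⟩
      exact hr (((inPit_iff hpq hqr).mp (h σ hσ)).1 h2)
  have m3 : υ.Less r p ↔ σ.Less r p :=
    hf.less_iff (fun e => (e.1 ▸ e.2 ▸ hij).not_gt hpr) (fun e => c3 ⟨e.2.symm, e.1.symm⟩)
  rw [inPeak_iff hpq hqr, inPit_iff hpq hqr, m1, m2, m3, ← inPeak_iff hpq hqr,
    ← inPit_iff hpq hqr]
  exact (hD _ _ _ hpq hqr).imp (fun h => ⟨h σ hσ, h⟩) (fun h => ⟨h σ hσ, h⟩)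

/-- Every peak-pit domain extends to a peak-pit domain with a chain of flips from `α` to `ω`. -/
theorem IsPeakPit.exists_chain {D : Set (LinOrd n)} (hD : IsPeakPit D) :
    ∃ D' : Set (LinOrd n), D ⊆ D' ∧ IsPeakPit D' ∧ ∃ (N : ℕ) (s : ℕ → LinOrd n),
      s 0 = alpha n ∧ s N = omega n ∧ (∀ m ≤ N, s m ∈ D') ∧
      ∀ m < N, ∃ i j, IsFlip (s m) (s (m + 1)) i j := by
  obtain ⟨D', hDD', hD'⟩ :=
    (Set.toFinite {D : Set (LinOrd n) | IsPeakPit D}).exists_le_maximal (a := D) hD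
  have hmax : ∀ σ, IsPeakPit (insert σ D') → σ ∈ D' := fun σ h =>
    hD'.2 h (Set.subset_insert _ _) (Set.mem_insert _ _)
  exact ⟨D', hDD', hD'.1, exists_flip_chain (hmax _ (IsPeakPit.insert_alpha hD'.1))
    fun σ hσ hω => exists_flip_of_maximal hD'.1 hmax hσ hω⟩

/-! ### Edges of members along a chain of flips -/

/-- The order `σ` ranks `a` and `c` differently from `α`. -/
def Opposed (σ : LinOrd n) (a c : Fin n) : Prop :=
  (a < c ∧ σ.Less c a) ∨ (c < a ∧ σ.Less a c)

theorem opposed_of_lt {σ : LinOrd n} {a c : Fin n} (h : a < c) :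
    Opposed σ a c ↔ σ.Less c a := by simp [Opposed, h, h.not_gt]

theorem opposed_of_gt {σ : LinOrd n} {a c : Fin n} (h : c < a) :
    Opposed σ a c ↔ σ.Less a c := by simp [Opposed, h, h.not_gt]

theorem before_eq_of_opposed {σ τ : LinOrd n} {c : Fin n}
    (h : ∀ a ≠ c, (Opposed σ a c ↔ Opposed τ a c)) : before σ c = before τ c := by
  ext a
  rw [mem_before, mem_before]
  rcases lt_trichotomy a c with hac | rfl | hac
  · have := h a hac.ne
    rw [opposed_of_lt hac, opposed_of_lt hac] at this
    rw [← σ.not_less_iff hac.ne', ← τ.not_less_iff hac.ne', this]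
  · simp [LinOrd.Less]
  · have := h a hac.ne'
    rwa [opposed_of_gt hac, opposed_of_gt hac] at this

theorem IsFlip.opposed_iff {σ τ : LinOrd n} {i j a c : Fin n} (h : IsFlip σ τ i j)
    (h1 : ¬ (a = i ∧ c = j)) (h2 : ¬ (a = j ∧ c = i)) : Opposed τ a c ↔ Opposed σ a c := by
  rw [Opposed, Opposed, h.less_iff h1 h2, h.less_iff (fun e => h2 ⟨e.2, e.1⟩)
    (fun e => h1 ⟨e.2, e.1⟩)]

/-- On a triple the inversion sets of members form a chain. The order `τ` shows that the pair ac
enters before dc, so a member opposing dc opposes ac. -/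
theorem IsPeakPit.opposed_of_opposed {D : Set (LinOrd n)} (hD : IsPeakPit D) {σ τ : LinOrd n}
    (hσ : σ ∈ D) (hτ : τ ∈ D) {a d c : Fin n} (had : a ≠ d) (hac : a ≠ c) (hdc : d ≠ c)
    (h1 : Opposed τ a c) (h2 : ¬ Opposed τ d c) (h3 : Opposed σ d c) : Opposed σ a c := by
  have key : ∀ i j k : Fin n, i < j → j < k →
      ((∀ σ ∈ D, (σ.Less j i → σ.Less k i) ∧ (σ.Less k i → σ.Less k j)) ∨
      (∀ σ ∈ D, (σ.Less k j → σ.Less k i) ∧ (σ.Less k i → σ.Less j i))) := fun i j k hij hjk =>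
    (hD i j k hij hjk).imp (fun h σ hσ => (inPeak_iff hij hjk).mp (h σ hσ))
      (fun h σ hσ => (inPit_iff hij hjk).mp (h σ hσ))
  rcases lt_or_gt_of_ne had with o1 | o1 <;> rcases lt_or_gt_of_ne hac with o2 | o2 <;>
    rcases lt_or_gt_of_ne hdc with o3 | o3 <;>
    simp only [opposed_of_lt, opposed_of_gt, o2, o3] at h1 h2 h3 ⊢
  · have := key a d c o1 o3
    grind
  · have := key a c d o2 o3
    grind
  · exact absurd (o1.trans o3) o2.asymm
  · have := key c a d o2 o1
    grind
  · have := key d a c o1 o2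
    grind
  · exact absurd (o3.trans o1) o2.asymm
  · have := key d c a o3 o2
    grind
  · have := key c d a o3 o1
    grind

/-- In a chain of flips inside a peak-pit domain, each edge of the path of any member of the
domain occurs on the path of some member of the chain. -/
theorem IsPeakPit.exists_before_eq {D : Set (LinOrd n)} (hD : IsPeakPit D) {N : ℕ}
    {s : ℕ → LinOrd n} (h0 : s 0 = alpha n) (hN : s N = omega n) (hs : ∀ m ≤ N, s m ∈ D)
    (hf : ∀ m < N, ∃ i j, IsFlip (s m) (s (m + 1)) i j) {τ : LinOrd n} (hτ : τ ∈ D) (c : Fin n) :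
    ∃ m ≤ N, before (s m) c = before τ c := by
  classical
  by_cases hall : ∃ m ≤ N, ∃ d, d ≠ c ∧ ¬ Opposed τ d c ∧ Opposed (s m) d c
  · obtain ⟨l, ⟨hm, d, hdc, hd, hd'⟩, hprev⟩ := Nat.findX hall
    obtain _ | m := l
    · rw [h0] at hd'
      rcases hd' with ⟨h, h'⟩ | ⟨h, h'⟩ <;> exact absurd h' h.asymm
    have hprev := hprev m (Nat.lt_succ_self m)
    push Not at hprev
    have hm' : ∀ a, a ≠ c → ¬ Opposed τ a c → ¬ Opposed (s m) a c := hprev (by omega)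
    obtain ⟨i, j, hij⟩ := hf m (by omega)
    have hpair : (d = i ∧ c = j) ∨ (d = j ∧ c = i) := by
      by_contra! hcon
      have := hij.opposed_iff (a := d) (c := c) (fun e => hcon.1 e.1 e.2) (fun e => hcon.2 e.1 e.2)
      exact hm' d hdc hd (this.mp hd')
    refine ⟨m, by omega, before_eq_of_opposed fun a hac => ⟨fun h => ?_, fun h => ?_⟩⟩
    · by_contra h'
      exact hm' a hac h' h
    · have had : a ≠ d := fun e => hd (e ▸ h)
      have h' := hD.opposed_of_opposed (hs _ hm) hτ had hac hdc h hd hd'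
      refine (hij.opposed_iff (fun e => ?_) (fun e => ?_)).mp h'
      · rcases hpair with hp | hp
        · exact had (e.1.trans hp.1.symm)
        · exact hdc (hp.1.trans e.2.symm)
      · rcases hpair with hp | hp
        · exact hdc (hp.1.trans e.2.symm)
        · exact had (e.1.trans hp.1.symm)
  · push Not at hall
    -- If this never happens, `τ` opposes all pairs with `c`, just as ω does.
    refine ⟨N, le_rfl, before_eq_of_opposed fun a hac => ⟨fun h => ?_, fun h => ?_⟩⟩
    · by_contra h'
      exact hall N le_rfl a hac h' h
    · rw [hN]
      rcases lt_or_gt_of_ne hac with h | h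
      · rw [opposed_of_lt h]; exact omega_less.mpr h
      · rw [opposed_of_gt h]; exact omega_less.mpr h

end CondorcetTiling

namespace CondorcetTiling

variable {n : ℕ} {ξ : ZonogonVectors n} {σ τ : LinOrd n}

/-! ### The path of a linear order as the graph of a function of the height -/

/-- The inverse slope of the vector of colour `c`. -/
noncomputable def slope (ξ : ZonogonVectors n) (c : Fin n) : ℝ := (ξ.vec c).1 / (ξ.vec c).2

theorem slope_mul (c : Fin n) : slope ξ c * (ξ.vec c).2 = (ξ.vec c).1 :=
  div_mul_cancel₀ _ (ξ.upper c).ne'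

theorem slope_lt {i j : Fin n} (h : i < j) : slope ξ i < slope ξ j := by
  rw [slope, slope, div_lt_div_iff₀ (ξ.upper i) (ξ.upper j)]
  linarith [ξ.clockwise i j h]

/-- The height at which the path of `σ` starts its edge of colour `c`. -/
def startHeight (ξ : ZonogonVectors n) (σ : LinOrd n) (c : Fin n) : ℝ :=
  (sumVec ξ (before σ c)).2

/-- The abscissa of the point of height `y` on the path of `σ`. -/
noncomputable def profile (ξ : ZonogonVectors n) (σ : LinOrd n) (y : ℝ) : ℝ :=
  ∑ c, slope ξ c * max 0 (min (ξ.vec c).2 (y - startHeight ξ σ c))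

theorem sumVec_snd_mono {A B : Finset (Fin n)} (h : A ⊆ B) :
    (sumVec ξ A).2 ≤ (sumVec ξ B).2 := by
  rw [sumVec_snd, sumVec_snd]
  exact Finset.sum_le_sum_of_subset_of_nonneg h fun c _ _ => (ξ.upper c).le

theorem startHeight_add_le {a c : Fin n} (h : σ.Less a c) :
    startHeight ξ σ a + (ξ.vec a).2 ≤ startHeight ξ σ c := by
  have hsub : insert a (before σ a) ⊆ before σ c := by
    intro x hx
    rw [Finset.mem_insert, mem_before] at hx
    rw [mem_before]
    rcases hx with rfl | hx
    · exact h
    · exact hx.trans h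
  have := sumVec_snd_mono (ξ := ξ) hsub
  rwa [sumVec_insert (notMem_before σ a)] at this

/-- At this height the colours before `c` contribute in full and those after it nothing. -/
theorem profile_eq {c : Fin n} {y : ℝ} (h1 : startHeight ξ σ c ≤ y)
    (h2 : y ≤ startHeight ξ σ c + (ξ.vec c).2) :
    profile ξ σ y = (sumVec ξ (before σ c)).1 + slope ξ c * (y - startHeight ξ σ c) := by
  classical
  have hterm : ∀ a ∈ Finset.univ, slope ξ a * max 0 (min (ξ.vec a).2 (y - startHeight ξ σ a)) =
      (if a ∈ before σ c then (ξ.vec a).1 else 0) +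
        (if a = c then slope ξ c * (y - startHeight ξ σ c) else 0) := by
    intro a _
    have ha := ξ.upper a
    by_cases hac : a = c
    · subst hac
      rw [if_neg (notMem_before σ a), if_pos rfl, zero_add, min_eq_right (by linarith),
        max_eq_right (by linarith)]
    · rw [if_neg hac, add_zero]
      rcases σ.less_or_less hac with h | h
      · have := startHeight_add_le (ξ := ξ) h
        rw [if_pos (mem_before.mpr h), min_eq_left (by linarith), max_eq_right ha.le, slope_mul]
      · have := startHeight_add_le (ξ := ξ) h
        rw [if_neg (fun h' => h.asymm (mem_before.mp h')),
          max_eq_left (le_trans (min_le_right _ _) (by linarith)), mul_zero]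
  rw [profile, Finset.sum_congr rfl hterm, Finset.sum_add_distrib, ← Finset.sum_filter,
    Finset.sum_ite_eq' Finset.univ c, sumVec_fst]
  simp

theorem eq_add_smul_of_profile {c : Fin n} {p : ℝ × ℝ} (hp : p.1 = profile ξ σ p.2)
    (h1 : startHeight ξ σ c ≤ p.2) (h2 : p.2 ≤ startHeight ξ σ c + (ξ.vec c).2) :
    p = sumVec ξ (before σ c) + ((p.2 - startHeight ξ σ c) / (ξ.vec c).2) • ξ.vec c := by
  rw [profile_eq h1 h2] at hp
  have hc := (ξ.upper c).ne'
  refine Prod.ext ?_ ?_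
  · simp only [Prod.fst_add, Prod.smul_fst, smul_eq_mul]
    rw [hp, slope]; ring
  · simp only [Prod.snd_add, Prod.smul_snd, smul_eq_mul]
    rw [div_mul_cancel₀ _ hc, startHeight]; ring

theorem exists_startHeight_le (σ : LinOrd n) {y : ℝ} (hn : 0 < n) (h0 : 0 ≤ y)
    (h1 : y ≤ (sumVec ξ Finset.univ).2) :
    ∃ c, startHeight ξ σ c ≤ y ∧ y ≤ startHeight ξ σ c + (ξ.vec c).2 := by
  classical
  have hex : ∃ k, k < n ∧ y ≤ (sumVec ξ (prefixSet σ (k + 1))).2 :=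
    ⟨n - 1, by omega, by rwa [Nat.sub_add_cancel hn, prefixSet_self]⟩
  obtain ⟨k, ⟨hk, hky⟩, hmin⟩ := Nat.findX hex
  have hs : startHeight ξ σ (σ ⟨k, hk⟩) = (sumVec ξ (prefixSet σ k)).2 := by
    rw [startHeight, before_apply]
  refine ⟨σ ⟨k, hk⟩, ?_, ?_⟩
  · rw [hs]
    obtain _ | k := k
    · simpa [prefixSet_zero, sumVec] using h0
    · have := hmin k (Nat.lt_succ_self k)
      push Not at this
      exact (this (by omega)).le
  · rw [hs]
    have := sumVec_prefixSet_succ (ξ := ξ) (σ := σ) ⟨k, hk⟩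
    rw [this] at hky
    exact hky

theorem profile_alpha_le (hn : 0 < n) {p : ℝ × ℝ} (hp : p ∈ zonogon ξ) :
    profile ξ (alpha n) p.2 ≤ p.1 := by
  obtain ⟨c, h1, h2⟩ := exists_startHeight_le (ξ := ξ) (alpha n) hn (zonogon_snd_nonneg hp)
    (zonogon_snd_le hp)
  have h := (detVec_alpha_le (c := c) hp).1
  rw [detVec_apply, detVec_apply] at h
  rw [profile_eq h1 h2]
  rw [startHeight]
  have hc := ξ.upper c
  rw [← slope_mul (ξ := ξ) c] at h
  nlinarith

theorem before_omega (c : Fin n) :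
    before (omega n) c = (insert c (before (alpha n) c))ᶜ := by
  ext a
  rw [mem_before, omega_less, Finset.mem_compl, Finset.mem_insert, mem_before, alpha_less, not_or,
    not_lt]
  constructor
  · exact fun h => ⟨h.ne', h.le⟩
  · exact fun h => lt_of_le_of_ne h.2 (Ne.symm h.1)

theorem sub_mem_zonogon {p : ℝ × ℝ} (hp : p ∈ zonogon ξ) :
    sumVec ξ Finset.univ - p ∈ zonogon ξ := by
  obtain ⟨a, ha, rfl⟩ := hp
  refine ⟨fun c => 1 - a c, fun c => ⟨by linarith [(ha c).2], by linarith [(ha c).1]⟩, ?_⟩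
  simp [sumVec, sub_smul]

/-- The point reflection of the zonogon carries the right boundary to the left one, where
`detVec_alpha_le` applies. -/
theorem le_profile_omega (hn : 0 < n) {p : ℝ × ℝ} (hp : p ∈ zonogon ξ) :
    p.1 ≤ profile ξ (omega n) p.2 := by
  obtain ⟨c, h1, h2⟩ := exists_startHeight_le (ξ := ξ) (omega n) hn (zonogon_snd_nonneg hp)
    (zonogon_snd_le hp)
  have h := (detVec_alpha_le (c := c) (sub_mem_zonogon hp)).1
  have hV : sumVec ξ (before (omega n) c) + (sumVec ξ (before (alpha n) c) + ξ.vec c) =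
      sumVec ξ Finset.univ := by
    rw [← sumVec_insert (notMem_before _ _), before_omega]
    exact Finset.sum_compl_add_sum _ _
  rw [← hV, ← sub_nonneg, ← map_sub] at h
  have h3 : sumVec ξ (before (omega n) c) + (sumVec ξ (before (alpha n) c) + ξ.vec c) - p -
      sumVec ξ (before (alpha n) c) = sumVec ξ (before (omega n) c) - p + ξ.vec c := by abel
  rw [h3, map_add, detVec_self, add_zero, detVec_apply] at h
  rw [profile_eq h1 h2, startHeight]
  have hc := ξ.upper c
  rw [← slope_mul (ξ := ξ) c, Prod.fst_sub, Prod.snd_sub] at h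
  nlinarith

/-! ### Tiles between the paths of a flip -/

/-- The tile `t` lies between the paths of `σ` and `τ`, which differ by a flip. -/
structure IsFlipTile (ξ : ZonogonVectors n) (σ τ : LinOrd n) (t : Tile n) : Prop where
  isFlip : IsFlip σ τ t.i t.j
  base : t.base = sumVec ξ (before σ t.i)

namespace IsFlipTile

variable {t : Tile n}

theorem start_i (h : IsFlipTile ξ σ τ t) : startHeight ξ σ t.i = t.base.2 := by
  rw [startHeight, h.base]

theorem before_j (h : IsFlipTile ξ σ τ t) : sumVec ξ (before σ t.j) = t.base + ξ.vec t.i := by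
  rw [h.isFlip.before_right, sumVec_insert (notMem_before _ _), h.base]

theorem start_j (h : IsFlipTile ξ σ τ t) :
    startHeight ξ σ t.j = t.base.2 + (ξ.vec t.i).2 := by
  rw [startHeight, h.before_j]; rfl

theorem before_j' (h : IsFlipTile ξ σ τ t) : sumVec ξ (before τ t.j) = t.base := by
  rw [h.isFlip.before_right', h.base]

theorem start_j' (h : IsFlipTile ξ σ τ t) : startHeight ξ τ t.j = t.base.2 := by
  rw [startHeight, h.before_j']

theorem before_i' (h : IsFlipTile ξ σ τ t) : sumVec ξ (before τ t.i) = t.base + ξ.vec t.j := by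
  rw [h.isFlip.before_left, sumVec_insert h.isFlip.right_notMem, h.base]

theorem start_i' (h : IsFlipTile ξ σ τ t) :
    startHeight ξ τ t.i = t.base.2 + (ξ.vec t.j).2 := by
  rw [startHeight, h.before_i']; rfl

theorem carrier_subset (h : IsFlipTile ξ σ τ t) : t.carrier ξ ⊆ zonogon ξ := by
  have := sumVec_mem_zonogon_aux (ξ := ξ) (notMem_before σ t.i) h.isFlip.right_notMem t.lt
  rwa [← h.base] at this

theorem profile_left (h : IsFlipTile ξ σ τ t) {y : ℝ} (h0 : t.base.2 ≤ y)
    (h1 : y ≤ t.base.2 + (ξ.vec t.i).2 + (ξ.vec t.j).2) :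
    (y ≤ t.base.2 + (ξ.vec t.i).2 ∧
      profile ξ σ y = t.base.1 + slope ξ t.i * (y - t.base.2)) ∨
    (t.base.2 + (ξ.vec t.i).2 ≤ y ∧ profile ξ σ y =
      t.base.1 + (ξ.vec t.i).1 + slope ξ t.j * (y - t.base.2 - (ξ.vec t.i).2)) := by
  rcases le_total y (t.base.2 + (ξ.vec t.i).2) with hy | hy
  · refine Or.inl ⟨hy, ?_⟩
    rw [profile_eq (c := t.i) (by rw [h.start_i]; exact h0) (by rw [h.start_i]; exact hy),
      h.start_i, ← h.base]
  · refine Or.inr ⟨hy, ?_⟩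
    rw [profile_eq (c := t.j) (by rw [h.start_j]; exact hy) (by rw [h.start_j]; exact h1),
      h.start_j, h.before_j, Prod.fst_add]
    ring

theorem profile_right (h : IsFlipTile ξ σ τ t) {y : ℝ} (h0 : t.base.2 ≤ y)
    (h1 : y ≤ t.base.2 + (ξ.vec t.i).2 + (ξ.vec t.j).2) :
    (y ≤ t.base.2 + (ξ.vec t.j).2 ∧
      profile ξ τ y = t.base.1 + slope ξ t.j * (y - t.base.2)) ∨
    (t.base.2 + (ξ.vec t.j).2 ≤ y ∧ profile ξ τ y =
      t.base.1 + (ξ.vec t.j).1 + slope ξ t.i * (y - t.base.2 - (ξ.vec t.j).2)) := by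
  rcases le_total y (t.base.2 + (ξ.vec t.j).2) with hy | hy
  · refine Or.inl ⟨hy, ?_⟩
    rw [profile_eq (c := t.j) (by rw [h.start_j']; exact h0) (by rw [h.start_j']; exact hy),
      h.start_j', h.before_j']
  · refine Or.inr ⟨hy, ?_⟩
    rw [profile_eq (c := t.i) (by rw [h.start_i']; exact hy) (by rw [h.start_i']; linarith),
      h.start_i', h.before_i', Prod.fst_add]
    ring

theorem profile_lt (h : IsFlipTile ξ σ τ t) {y : ℝ} (h0 : t.base.2 < y)
    (h1 : y < t.base.2 + (ξ.vec t.i).2 + (ξ.vec t.j).2) :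
    profile ξ σ y < profile ξ τ y := by
  have hs := slope_lt (ξ := ξ) t.lt
  have hi := ξ.upper t.i
  have hj := ξ.upper t.j
  have ei := slope_mul (ξ := ξ) t.i
  have ej := slope_mul (ξ := ξ) t.j
  rcases h.profile_left h0.le h1.le with ⟨l1, l2⟩ | ⟨l1, l2⟩ <;>
    rcases h.profile_right h0.le h1.le with ⟨r1, r2⟩ | ⟨r1, r2⟩ <;>
    rw [l2, r2] <;> nlinarith

theorem profile_eq_of_le (h : IsFlipTile ξ σ τ t) {y : ℝ} (hy : y ≤ t.base.2) :
    profile ξ σ y = profile ξ τ y := by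
  have hi := ξ.upper t.i
  have hj := ξ.upper t.j
  refine Finset.sum_congr rfl fun c _ => ?_
  have z : ∀ {w v : ℝ}, v ≤ 0 → max 0 (min w v) = 0 := fun hv =>
    max_eq_left ((min_le_right _ _).trans hv)
  by_cases ci : c = t.i
  · subst ci
    rw [h.start_i, h.start_i', z (by linarith), z (by linarith)]
  · by_cases cj : c = t.j
    · subst cj
      rw [h.start_j, h.start_j', z (by linarith), z (by linarith)]
    · rw [startHeight, startHeight, h.isFlip.before_of_ne ci cj]

theorem profile_eq_of_ge (h : IsFlipTile ξ σ τ t) {y : ℝ}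
    (hy : t.base.2 + (ξ.vec t.i).2 + (ξ.vec t.j).2 ≤ y) :
    profile ξ σ y = profile ξ τ y := by
  have hi := ξ.upper t.i
  have hj := ξ.upper t.j
  refine Finset.sum_congr rfl fun c _ => ?_
  have z : ∀ {w v : ℝ}, w ≤ v → max 0 (min w v) = max 0 w := fun hv => by rw [min_eq_left hv]
  by_cases ci : c = t.i
  · subst ci
    rw [h.start_i, h.start_i', z (by linarith), z (by linarith)]
  · by_cases cj : c = t.j
    · subst cj
      rw [h.start_j, h.start_j', z (by linarith), z (by linarith)]
    · rw [startHeight, startHeight, h.isFlip.before_of_ne ci cj]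

theorem profile_le (h : IsFlipTile ξ σ τ t) (y : ℝ) : profile ξ σ y ≤ profile ξ τ y := by
  rcases le_or_gt y t.base.2 with h0 | h0
  · exact (h.profile_eq_of_le h0).le
  · rcases le_or_gt (t.base.2 + (ξ.vec t.i).2 + (ξ.vec t.j).2) y with h1 | h1
    · exact (h.profile_eq_of_ge h1).le
    · exact (h.profile_lt h0 h1).le

theorem height_of_profile_lt (h : IsFlipTile ξ σ τ t) {y : ℝ}
    (hy : profile ξ σ y < profile ξ τ y) :
    t.base.2 < y ∧ y < t.base.2 + (ξ.vec t.i).2 + (ξ.vec t.j).2 := by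
  constructor
  · by_contra! h'
    exact hy.ne (h.profile_eq_of_le h')
  · by_contra! h'
    exact hy.ne (h.profile_eq_of_ge h')

/-- Write a point in the basis of the two tile vectors. The left profile encodes b ≥ 0 and a ≤ 1,
the right profile a ≥ 0 and b ≤ 1. -/
theorem mem_carrier_iff (h : IsFlipTile ξ σ τ t) {p : ℝ × ℝ} : p ∈ t.carrier ξ ↔
    (t.base.2 ≤ p.2 ∧ p.2 ≤ t.base.2 + (ξ.vec t.i).2 + (ξ.vec t.j).2) ∧
      profile ξ σ p.2 ≤ p.1 ∧ p.1 ≤ profile ξ τ p.2 := by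
  have hs := sub_pos.mpr (slope_lt (ξ := ξ) t.lt)
  have hi := ξ.upper t.i
  have hj := ξ.upper t.j
  have ei := slope_mul (ξ := ξ) t.i
  have ej := slope_mul (ξ := ξ) t.j
  constructor
  · rintro ⟨a, b, ⟨ha0, ha1⟩, ⟨hb0, hb1⟩, rfl⟩
    simp only [Prod.fst_add, Prod.snd_add, Prod.smul_fst, Prod.smul_snd, smul_eq_mul]
    have q1 : 0 ≤ a * (ξ.vec t.i).2 := by positivity
    have q2 : 0 ≤ b * (ξ.vec t.j).2 := by positivity
    have q3 : 0 ≤ (1 - a) * (ξ.vec t.i).2 := mul_nonneg (by linarith) hi.le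
    have q4 : 0 ≤ (1 - b) * (ξ.vec t.j).2 := mul_nonneg (by linarith) hj.le
    have b0 : t.base.2 ≤ t.base.2 + a * (ξ.vec t.i).2 + b * (ξ.vec t.j).2 := by linarith
    have b1 : t.base.2 + a * (ξ.vec t.i).2 + b * (ξ.vec t.j).2 ≤
        t.base.2 + (ξ.vec t.i).2 + (ξ.vec t.j).2 := by linarith
    refine ⟨⟨b0, b1⟩, ?_, ?_⟩
    · rcases h.profile_left b0 b1 with ⟨-, l⟩ | ⟨-, l⟩
      · rw [l, ← ei, ← ej]
        nlinarith [mul_nonneg hs.le q2]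
      · rw [l, ← ei, ← ej]
        nlinarith [mul_nonneg hs.le q3]
    · rcases h.profile_right b0 b1 with ⟨-, l⟩ | ⟨-, l⟩
      · rw [l, ← ei, ← ej]
        nlinarith [mul_nonneg hs.le q1]
      · rw [l, ← ei, ← ej]
        nlinarith [mul_nonneg hs.le q4]
  · rintro ⟨⟨b0, b1⟩, hl, hr⟩
    -- the contributions of the two vectors to the height
    set u := p.2 - t.base.2 with hu
    set v := p.1 - t.base.1 with hv
    set d := slope ξ t.j - slope ξ t.i with hd
    have hA : ∃ α, α * d = slope ξ t.j * u - v := ⟨(slope ξ t.j * u - v) / d, by field_simp⟩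
    obtain ⟨α, hα⟩ := hA
    have hβ : (u - α) * d = v - slope ξ t.i * u := by
      rw [sub_mul, hα, hd]; ring
    have key : 0 ≤ α ∧ α ≤ (ξ.vec t.i).2 ∧ 0 ≤ u - α ∧ u - α ≤ (ξ.vec t.j).2 := by
      have L : 0 ≤ u - α ∧ α ≤ (ξ.vec t.i).2 := by
        rcases h.profile_left b0 b1 with ⟨hy, l⟩ | ⟨hy, l⟩
        · have : 0 ≤ (u - α) * d := by rw [hβ]; linarith
          have := nonneg_of_mul_nonneg_left this hs
          exact ⟨this, by linarith⟩
        · have : 0 ≤ ((ξ.vec t.i).2 - α) * d := by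
            rw [sub_mul, hα, hd]; nlinarith
          have := nonneg_of_mul_nonneg_left this hs
          exact ⟨by linarith, by linarith⟩
      have R : 0 ≤ α ∧ u - α ≤ (ξ.vec t.j).2 := by
        rcases h.profile_right b0 b1 with ⟨hy, l⟩ | ⟨hy, l⟩
        · have : 0 ≤ α * d := by rw [hα]; linarith
          have := nonneg_of_mul_nonneg_left this hs
          exact ⟨this, by linarith⟩
        · have : 0 ≤ ((ξ.vec t.j).2 - (u - α)) * d := by
            rw [sub_mul, hβ, hd]; nlinarith
          have := nonneg_of_mul_nonneg_left this hs
          exact ⟨by linarith, by linarith⟩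
      exact ⟨R.1, L.2, L.1, R.2⟩
    obtain ⟨k1, k2, k3, k4⟩ := key
    refine ⟨α / (ξ.vec t.i).2, (u - α) / (ξ.vec t.j).2, ⟨div_nonneg k1 hi.le,
      (div_le_one hi).mpr k2⟩, ⟨div_nonneg k3 hj.le, (div_le_one hj).mpr k4⟩, Prod.ext ?_ ?_⟩
    · simp only [Prod.fst_add, Prod.smul_fst, smul_eq_mul]
      rw [← ei, ← ej]
      field_simp
      have : v = α * slope ξ t.i + (u - α) * slope ξ t.j := by
        rw [hd] at hα; linarith
      linarith
    · simp only [Prod.snd_add, Prod.smul_snd, smul_eq_mul]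
      rw [div_mul_cancel₀ _ hi.ne', div_mul_cancel₀ _ hj.ne']
      linarith

end IsFlipTile

end CondorcetTiling

namespace CondorcetTiling

variable {n : ℕ} {ξ : ZonogonVectors n}

/-! ### Intersections of tiles -/

/-- The right edges of a tile. -/
def Tile.IsRightEdge (ξ : ZonogonVectors n) (t : Tile n) (e : (ℝ × ℝ) × Fin n) : Prop :=
  e = (t.base, t.j) ∨ e = (t.base + ξ.vec t.j, t.i)

/-- The left edges of a tile. -/
def Tile.IsLeftEdge (ξ : ZonogonVectors n) (t : Tile n) (e : (ℝ × ℝ) × Fin n) : Prop :=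
  e = (t.base, t.i) ∨ e = (t.base + ξ.vec t.i, t.j)

namespace Tile

variable {t : Tile n} {e : (ℝ × ℝ) × Fin n} {p : ℝ × ℝ}

theorem IsRightEdge.mem_edges (h : t.IsRightEdge ξ e) : e ∈ t.edges ξ := by
  rcases h with rfl | rfl <;> simp [edges]

theorem IsLeftEdge.mem_edges (h : t.IsLeftEdge ξ e) : e ∈ t.edges ξ := by
  rcases h with rfl | rfl <;> simp [edges]

theorem edgeSegment_subset (h : e ∈ t.edges ξ) : edgeSegment ξ e ⊆ t.carrier ξ := by
  have hv := mem_vertices_of_mem_edges h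
  exact t.convex_carrier.segment_subset (vertices_subset_carrier hv.1)
    (vertices_subset_carrier hv.2)

theorem IsLeftEdge.detVec_le (h : t.IsLeftEdge ξ e) (hp : p ∈ t.carrier ξ) :
    detVec ξ e.2 e.1 ≤ detVec ξ e.2 p := by
  obtain ⟨a, b, ha, hb, rfl⟩ := hp
  rcases h with rfl | rfl
  · have := mul_nonneg hb.1 (detVec_pos (ξ := ξ) t.lt).le
    simp only [map_add, map_smul, smul_eq_mul, detVec_self]
    linarith
  · have := mul_nonneg_of_nonpos_of_nonpos (sub_nonpos.mpr ha.2) (detVec_neg (ξ := ξ) t.lt).le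
    simp only [map_add, map_smul, smul_eq_mul, detVec_self]
    linarith

theorem IsRightEdge.mem_edgeSegment (h : t.IsRightEdge ξ e) (hp : p ∈ t.carrier ξ)
    (hle : detVec ξ e.2 e.1 ≤ detVec ξ e.2 p) : p ∈ edgeSegment ξ e := by
  obtain ⟨a, b, ha, hb, rfl⟩ := hp
  rw [edgeSegment, segment_eq_image']
  rcases h with rfl | rfl
  · have hd := detVec_neg (ξ := ξ) t.lt
    simp only [map_add, map_smul, smul_eq_mul, detVec_self] at hle
    have ha0 : a = 0 := by nlinarith [ha.1]
    exact ⟨b, hb, by simp [ha0]⟩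
  · have hd := detVec_pos (ξ := ξ) t.lt
    simp only [map_add, map_smul, smul_eq_mul, detVec_self] at hle
    have hb1 : b = 1 := by nlinarith [hb.2]
    refine ⟨a, ha, ?_⟩
    simp only [hb1, add_sub_cancel_left]
    module

theorem mem_vertices_iff : p ∈ t.vertices ξ ↔ ∃ a b : ℝ, (a = 0 ∨ a = 1) ∧ (b = 0 ∨ b = 1) ∧
    p = t.base + a • ξ.vec t.i + b • ξ.vec t.j := by
  constructor
  · intro h
    simp only [vertices, Set.mem_insert_iff, Set.mem_singleton_iff] at h
    rcases h with rfl | rfl | rfl | rfl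
    · exact ⟨0, 0, by simp⟩
    · exact ⟨1, 0, by simp⟩
    · exact ⟨0, 1, by simp⟩
    · exact ⟨1, 1, by simp⟩
  · rintro ⟨a, b, rfl | rfl, rfl | rfl, rfl⟩ <;> simp [vertices]

theorem eq_of_midpoint_mem_vertices {q : ℝ × ℝ} (hp : p ∈ t.vertices ξ) (hq : q ∈ t.vertices ξ)
    (h : (1 / 2 : ℝ) • p + (1 / 2 : ℝ) • q ∈ t.vertices ξ) : p = q := by
  obtain ⟨a, b, ha, hb, rfl⟩ := mem_vertices_iff.mp hp
  obtain ⟨a', b', ha', hb', rfl⟩ := mem_vertices_iff.mp hq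
  obtain ⟨a'', b'', ha'', hb'', h⟩ := mem_vertices_iff.mp h
  have key : t.base + ((a + a') / 2) • ξ.vec t.i + ((b + b') / 2) • ξ.vec t.j =
      t.base + a'' • ξ.vec t.i + b'' • ξ.vec t.j := by
    rw [← h]; module
  have hmid : ∀ x y z : ℝ, (x = 0 ∨ x = 1) → (y = 0 ∨ y = 1) → (z = 0 ∨ z = 1) →
      (x + y) / 2 = z → x = y := by
    rintro x y z (rfl | rfl) (rfl | rfl) (rfl | rfl) <;> norm_num
  obtain ⟨h1, h2⟩ := coord_inj key
  rw [hmid a a' a'' ha ha' ha'' h1, hmid b b' b'' hb hb' hb'' h2]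

end Tile

/-- The line through `e` separates the tiles, and `s` touches it only in `e`. -/
theorem inter_eq_edgeSegment {s t : Tile n} {e : (ℝ × ℝ) × Fin n} (hs : s.IsRightEdge ξ e)
    (ht : t.IsLeftEdge ξ e) : s.carrier ξ ∩ t.carrier ξ = edgeSegment ξ e :=
  Set.Subset.antisymm (fun _ hp => hs.mem_edgeSegment hp.1 (ht.detVec_le hp.2))
    (Set.subset_inter (Tile.edgeSegment_subset hs.mem_edges)
      (Tile.edgeSegment_subset ht.mem_edges))

/-- Without a shared edge, all common points are vertices. The intersection is convex and the
midpoint of two distinct vertices is no vertex, so there is only one common point. -/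
theorem inter_of_forall {s t : Tile n} (hne : (s.carrier ξ ∩ t.carrier ξ).Nonempty)
    (h : ∀ p ∈ s.carrier ξ ∩ t.carrier ξ,
      (∃ e, s.IsRightEdge ξ e ∧ t.IsLeftEdge ξ e) ∨ p ∈ s.vertices ξ ∩ t.vertices ξ) :
    (∃ p ∈ s.vertices ξ ∩ t.vertices ξ, s.carrier ξ ∩ t.carrier ξ = {p}) ∨
    (∃ e ∈ s.edges ξ ∩ t.edges ξ, s.carrier ξ ∩ t.carrier ξ = edgeSegment ξ e) := by
  by_cases hedge : ∃ e, s.IsRightEdge ξ e ∧ t.IsLeftEdge ξ e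
  · obtain ⟨e, hs, ht⟩ := hedge
    exact Or.inr ⟨e, ⟨hs.mem_edges, ht.mem_edges⟩, inter_eq_edgeSegment hs ht⟩
  · replace h := fun p hp => (h p hp).resolve_left hedge
    obtain ⟨p, hp⟩ := hne
    refine Or.inl ⟨p, h p hp, Set.eq_singleton_iff_unique_mem.mpr ⟨hp, fun q hq => ?_⟩⟩
    have hm := (s.convex_carrier (ξ := ξ).inter t.convex_carrier) hq hp
      (show (0 : ℝ) ≤ 1 / 2 by norm_num) (show (0 : ℝ) ≤ 1 / 2 by norm_num) (by norm_num)
    exact Tile.eq_of_midpoint_mem_vertices (h q hq).1 (h p hp).1 (h _ hm).1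

/-! ### The tiling given by a chain of flips -/

theorem IsFlip.prefixSet_eq {σ τ : LinOrd n} {i j : Fin n} (h : IsFlip σ τ i j) {k : ℕ}
    (hk : k ≠ (σ.symm i : ℕ) + 1) : prefixSet τ k = prefixSet σ k := by
  ext a
  rw [mem_prefixSet, mem_prefixSet]
  have hadj := h.adjacent
  by_cases ai : a = i
  · subst ai; rw [h.symm_left]; omega
  · by_cases aj : a = j
    · subst aj; rw [h.symm_right]; omega
    · rw [h.symm_of_ne ai aj]

theorem prefixSet_snd_lt {σ : LinOrd n} {k l : ℕ} (hkl : k < l) (hl : l ≤ n) :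
    (sumVec ξ (prefixSet σ k)).2 < (sumVec ξ (prefixSet σ l)).2 := by
  have h1 := sumVec_prefixSet_succ (ξ := ξ) (σ := σ) ⟨k, by omega⟩
  have h2 : prefixSet σ (k + 1) ⊆ prefixSet σ l := by
    intro a ha
    rw [mem_prefixSet] at ha ⊢
    omega
  have h3 := sumVec_snd_mono (ξ := ξ) h2
  have h4 := ξ.upper (σ ⟨k, by omega⟩)
  rw [h1, Prod.snd_add] at h3
  simp only at h3
  linarith

/-- A chain of flips from `α` to `ω` together with the tiles between consecutive paths. -/
structure IsTileChain (ξ : ZonogonVectors n) (N : ℕ) (s : ℕ → LinOrd n) (t : ℕ → Tile n) :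
    Prop where
  zero : s 0 = alpha n
  last : s N = omega n
  flip : ∀ m < N, IsFlipTile ξ (s m) (s (m + 1)) (t m)

open Classical in
/-- The set of the tiles of a chain. -/
noncomputable def chainTiles (N : ℕ) (t : ℕ → Tile n) : Finset (Tile n) :=
  (Finset.range N).image t

theorem mem_chainTiles {N : ℕ} {t : ℕ → Tile n} {u : Tile n} :
    u ∈ chainTiles N t ↔ ∃ m < N, t m = u := by
  simp [chainTiles]

namespace IsTileChain

variable {N : ℕ} {s : ℕ → LinOrd n} {t : ℕ → Tile n}

theorem profile_mono (h : IsTileChain ξ N s t) (y : ℝ) {a b : ℕ} (hab : a ≤ b) (hb : b ≤ N) :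
    profile ξ (s a) y ≤ profile ξ (s b) y := by
  induction b, hab using Nat.le_induction with
  | base => exact le_rfl
  | succ b hab ih => exact (ih (by omega)).trans ((h.flip b (by omega)).profile_le y)

/-- With at least two colours, each edge of the leftmost path is absent from the rightmost one. The
first flip that removes it does so across a tile having it as a left edge. -/
theorem edgesIn_alpha (hn : 2 ≤ n) (h : IsTileChain ξ N s t) :
    EdgesIn ξ (chainTiles N t) (alpha n) := by
  classical
  intro c
  have hne : before (s N) c ≠ before (alpha n) c := by
    obtain ⟨d, hd⟩ : ∃ d : Fin n, d ≠ c := by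
      have : Nontrivial (Fin n) := Fin.nontrivial_iff_two_le.mpr hn
      exact exists_ne c
    intro he
    have := Finset.ext_iff.mp he d
    rw [h.last, mem_before, mem_before, omega_less, alpha_less] at this
    rcases lt_or_gt_of_ne hd with h' | h'
    · exact h'.asymm (this.mpr h')
    · exact h'.asymm (this.mp h')
  have hex : ∃ m, m ≤ N ∧ before (s m) c ≠ before (alpha n) c := ⟨N, le_rfl, hne⟩
  obtain ⟨m, ⟨hm, hmc⟩, hmin⟩ := Nat.findX hex
  obtain _ | m := m
  · exact absurd (by rw [h.zero]) hmc
  have hprev : before (s m) c = before (alpha n) c := by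
    by_contra h'
    exact hmin m (Nat.lt_succ_self m) ⟨by omega, h'⟩
  have hf := h.flip m (by omega)
  rw [← hprev] at hmc ⊢
  refine mem_graphEdges.mpr ⟨t m, mem_chainTiles.mpr ⟨m, by omega, rfl⟩, ?_⟩
  by_cases ci : c = (t m).i
  · rw [ci, ← hf.base]; simp [Tile.edges]
  · by_cases cj : c = (t m).j
    · rw [cj, hf.before_j]; simp [Tile.edges]
    · exact absurd (hf.isFlip.before_of_ne ci cj) hmc

theorem edgesIn (hn : 2 ≤ n) (h : IsTileChain ξ N s t) {m : ℕ} (hm : m ≤ N) :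
    EdgesIn ξ (chainTiles N t) (s m) := by
  induction m with
  | zero => rw [h.zero]; exact h.edgesIn_alpha hn
  | succ m ih =>
    have hf := h.flip m (by omega)
    refine (ih (by omega)).of_isFlip hf.isFlip (mem_chainTiles.mpr ⟨m, by omega, ?_⟩)
    rw [← hf.base]

theorem carrier_subset (h : IsTileChain ξ N s t) {u : Tile n} (hu : u ∈ chainTiles N t) :
    u.carrier ξ ⊆ zonogon ξ := by
  obtain ⟨m, hm, rfl⟩ := mem_chainTiles.mp hu
  exact (h.flip m hm).carrier_subset

theorem cover (hn : 2 ≤ n) (h : IsTileChain ξ N s t) :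
    (⋃ u ∈ chainTiles N t, u.carrier ξ) = zonogon ξ := by
  classical
  refine Set.Subset.antisymm (Set.iUnion₂_subset fun u hu => h.carrier_subset hu) fun p hp => ?_
  rw [Set.mem_iUnion₂]
  have hα := profile_alpha_le (by omega) hp
  have hω := le_profile_omega (by omega) hp
  rcases hω.lt_or_eq with hlt | heq
  -- The tile sought is the one swept when the paths first pass strictly to the right of `p`; points
  -- on the right boundary are never passed and lie on edges of the last path.
  · have hex : ∃ m, m ≤ N ∧ p.1 < profile ξ (s m) p.2 := ⟨N, le_rfl, h.last ▸ hlt⟩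
    obtain ⟨m, ⟨hm, hpm⟩, hmin⟩ := Nat.findX hex
    obtain _ | m := m
    · rw [h.zero] at hpm
      exact absurd hα (not_le.mpr hpm)
    have hprev : profile ξ (s m) p.2 ≤ p.1 := by
      by_contra! h'
      exact hmin m (Nat.lt_succ_self m) ⟨by omega, h'⟩
    have hf := h.flip m (by omega)
    have hy := hf.height_of_profile_lt (hprev.trans_lt hpm)
    exact ⟨t m, mem_chainTiles.mpr ⟨m, by omega, rfl⟩,
      hf.mem_carrier_iff.mpr ⟨⟨hy.1.le, hy.2.le⟩, hprev, hpm.le⟩⟩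
  · obtain ⟨c, h1, h2⟩ := exists_startHeight_le (ξ := ξ) (omega n) (by omega)
      (zonogon_snd_nonneg hp) (zonogon_snd_le hp)
    have he := h.edgesIn hn le_rfl c
    rw [h.last] at he
    obtain ⟨u, hu, hue⟩ := mem_graphEdges.mp he
    refine ⟨u, hu, Tile.edgeSegment_subset hue ?_⟩
    rw [edgeSegment, segment_eq_image']
    have hc := ξ.upper c
    refine ⟨(p.2 - startHeight ξ (omega n) c) / (ξ.vec c).2,
      ⟨div_nonneg (by linarith) hc.le, (div_le_one hc).mpr (by linarith)⟩, ?_⟩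
    simp only [add_sub_cancel_left]
    exact (eq_add_smul_of_profile heq h1 h2).symm

/-- While the path does not move at the height of an inner point of one of its edges, the edge
stays on the path. -/
theorem before_eq_of_profile_eq (h : IsTileChain ξ N s t) {y : ℝ} {c : Fin n} {a b : ℕ}
    (hab : a ≤ b) (hb : b ≤ N)
    (heq : ∀ m, a ≤ m → m < b → profile ξ (s m) y = profile ξ (s (m + 1)) y)
    (h1 : startHeight ξ (s a) c < y) (h2 : y < startHeight ξ (s a) c + (ξ.vec c).2) :
    before (s b) c = before (s a) c := by
  induction b, hab using Nat.le_induction with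
  | base => rfl
  | succ b hab ih =>
    have ih := ih (by omega) fun m hm hm' => heq m hm (by omega)
    rw [← ih]
    have hf := h.flip b (by omega)
    have hst : startHeight ξ (s b) c = startHeight ξ (s a) c := by rw [startHeight, ih, startHeight]
    rw [← hst] at h1 h2
    have hi := ξ.upper (t b).i
    have hj := ξ.upper (t b).j
    refine hf.isFlip.before_of_ne (fun e => ?_) (fun e => ?_)
    · subst e
      rw [hf.start_i] at h1 h2
      exact (hf.profile_lt h1 (by linarith)).ne (heq b hab (Nat.lt_succ_self b))
    · subst e
      rw [hf.start_j] at h1 h2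
      exact (hf.profile_lt (by linarith) h2).ne (heq b hab (Nat.lt_succ_self b))

/-- While the path does not move at the height of one of its vertices, the vertex stays on the
path. -/
theorem prefixSet_eq_of_profile_eq (h : IsTileChain ξ N s t) {y : ℝ} {k : ℕ} {a b : ℕ}
    (hab : a ≤ b) (hb : b ≤ N)
    (heq : ∀ m, a ≤ m → m < b → profile ξ (s m) y = profile ξ (s (m + 1)) y)
    (hy : (sumVec ξ (prefixSet (s a) k)).2 = y) :
    prefixSet (s b) k = prefixSet (s a) k := by
  induction b, hab using Nat.le_induction with
  | base => rfl
  | succ b hab ih =>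
    have ih := ih (by omega) fun m hm hm' => heq m hm (by omega)
    rw [← ih] at hy ⊢
    have hf := h.flip b (by omega)
    have hi := ξ.upper (t b).i
    have hj := ξ.upper (t b).j
    refine hf.isFlip.prefixSet_eq fun e => ?_
    have hs := hf.start_j
    rw [startHeight, before, hf.isFlip.adjacent, ← e, hy] at hs
    exact (hf.profile_lt (by linarith) (by linarith)).ne (heq b hab (Nat.lt_succ_self b))

/-- A common point is right of no path after `a` and left of none up to `b`, so all paths from `a +
1` to `b` pass through it. If it is inside an edge, that edge persists and is shared; if it is a
vertex, that vertex persists. -/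
theorem inter_of_lt (h : IsTileChain ξ N s t) {a b : ℕ} (hab : a < b) (hb : b < N) {p : ℝ × ℝ}
    (hpa : p ∈ (t a).carrier ξ) (hpb : p ∈ (t b).carrier ξ) :
    (∃ e, (t a).IsRightEdge ξ e ∧ (t b).IsLeftEdge ξ e) ∨
      p ∈ (t a).vertices ξ ∩ (t b).vertices ξ := by
  have hfa := h.flip a (by omega)
  have hfb := h.flip b hb
  obtain ⟨⟨a0, a1⟩, -, a3⟩ := hfa.mem_carrier_iff.mp hpa
  obtain ⟨⟨b0, b1⟩, b2, -⟩ := hfb.mem_carrier_iff.mp hpb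
  have heq : ∀ m, a + 1 ≤ m → m ≤ b → p.1 = profile ξ (s m) p.2 := fun m h1 h2 =>
    le_antisymm (a3.trans (h.profile_mono _ h1 (by omega)))
      ((h.profile_mono _ h2 (by omega)).trans b2)
  have hpeq : ∀ m, a + 1 ≤ m → m < b → profile ξ (s m) p.2 = profile ξ (s (m + 1)) p.2 :=
    fun m h1 h2 => (heq m h1 h2.le).symm.trans (heq (m + 1) (by omega) h2)
  obtain ⟨c, hc, c1, c2⟩ : ∃ c, (t a).IsRightEdge ξ (sumVec ξ (before (s (a + 1)) c), c) ∧
      startHeight ξ (s (a + 1)) c ≤ p.2 ∧ p.2 ≤ startHeight ξ (s (a + 1)) c + (ξ.vec c).2 := by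
    rcases le_total p.2 ((t a).base.2 + (ξ.vec (t a).j).2) with hy | hy
    · exact ⟨(t a).j, Or.inl (by rw [hfa.before_j']), by rwa [hfa.start_j'],
        by rwa [hfa.start_j']⟩
    · exact ⟨(t a).i, Or.inr (by rw [hfa.before_i']), by rwa [hfa.start_i'],
        by rw [hfa.start_i']; linarith⟩
  have vertex : ∀ k, k ≤ n → p = sumVec ξ (prefixSet (s (a + 1)) k) → p ∈ (t b).vertices ξ := by
    intro k hk hp
    have hpre := h.prefixSet_eq_of_profile_eq (y := p.2) (k := k) hab hb.le hpeq (by rw [← hp])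
    rw [← hpre] at hp
    obtain ⟨q, hq⟩ : ∃ q : ℕ, q = ((s b).symm (t b).i : ℕ) := ⟨_, rfl⟩
    have hadj := hfb.isFlip.adjacent
    rw [← hq] at hadj
    have hqn : q + 1 < n := hadj ▸ ((s b).symm (t b).j).isLt
    have e0 : sumVec ξ (prefixSet (s b) q) = (t b).base := by
      rw [hq]; exact hfb.base.symm
    have e1 : sumVec ξ (prefixSet (s b) (q + 1)) = (t b).base + ξ.vec (t b).i := by
      rw [← hfb.before_j, before, hadj]
    have e2 : sumVec ξ (prefixSet (s b) (q + 2)) =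
        (t b).base + ξ.vec (t b).i + ξ.vec (t b).j := by
      have := sumVec_prefixSet_succ (ξ := ξ) (σ := s b) ((s b).symm (t b).j)
      rw [hadj, e1, Equiv.apply_symm_apply] at this
      exact this
    -- Heights increase strictly along a path, so a path vertex within the height range of the tile
    -- is one of three consecutive ones, all on the left side of the tile.
    have k1 : q ≤ k := by
      by_contra! hlt
      have := prefixSet_snd_lt (ξ := ξ) (σ := s b) hlt (by omega)
      rw [← hp, e0] at this
      linarith
    have k2 : k ≤ q + 2 := by
      by_contra! hlt
      have := prefixSet_snd_lt (ξ := ξ) (σ := s b) hlt hk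
      rw [← hp, e2] at this
      simp only [Prod.snd_add] at this
      linarith
    obtain rfl | rfl | rfl : k = q ∨ k = q + 1 ∨ k = q + 2 := by omega
    · rw [hp, e0]; simp [Tile.vertices]
    · rw [hp, e1]; simp [Tile.vertices]
    · rw [hp, e2]; simp [Tile.vertices]
  have hcv := Tile.mem_vertices_of_mem_edges hc.mem_edges
  have hpc := eq_add_smul_of_profile (heq (a + 1) le_rfl hab) c1 c2
  have hcpos := ξ.upper c
  rcases c1.eq_or_lt with d1 | d1
  · right
    rw [← d1, sub_self, zero_div, zero_smul, add_zero] at hpc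
    exact ⟨hpc ▸ hcv.1, vertex _ ((s (a + 1)).symm c).isLt.le hpc⟩
  rcases c2.eq_or_lt with d2 | d2
  · right
    have hone : (p.2 - startHeight ξ (s (a + 1)) c) / (ξ.vec c).2 = 1 := by
      rw [d2, add_sub_cancel_left, div_self hcpos.ne']
    rw [hone, one_smul] at hpc
    refine ⟨hpc ▸ hcv.2, vertex _ ((s (a + 1)).symm c).isLt ?_⟩
    rw [hpc, sumVec_prefixSet_succ, Equiv.apply_symm_apply]
    rfl
  left
  refine ⟨_, hc, ?_⟩
  have hbef := h.before_eq_of_profile_eq hab hb.le hpeq d1 d2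
  rw [startHeight, ← hbef] at d1 d2
  rw [← hbef]
  have huniq : ∀ d, startHeight ξ (s b) d ≤ p.2 →
      p.2 ≤ startHeight ξ (s b) d + (ξ.vec d).2 → c = d := by
    intro d e1 e2
    by_contra hne
    rcases (s b).less_or_less hne with hl | hl
    · exact absurd (startHeight_add_le (ξ := ξ) hl) (not_le.mpr (e1.trans_lt d2))
    · exact absurd (startHeight_add_le (ξ := ξ) hl) (not_le.mpr (d1.trans_le e2))
  rcases le_total p.2 ((t b).base.2 + (ξ.vec (t b).i).2) with hy | hy
  · have := huniq (t b).i (by rwa [hfb.start_i]) (by rwa [hfb.start_i])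
    left
    rw [this, hfb.base]
  · have := huniq (t b).j (by rwa [hfb.start_j]) (by rwa [hfb.start_j])
    right
    rw [this, hfb.before_j]

theorem isTiling (hn : 2 ≤ n) (h : IsTileChain ξ N s t) : IsTiling ξ (chainTiles N t) where
  cover := h.cover hn
  inter := by
    intro u hu v hv huv hne
    obtain ⟨a, ha, rfl⟩ := mem_chainTiles.mp hu
    obtain ⟨b, hb, rfl⟩ := mem_chainTiles.mp hv
    have hab : a ≠ b := fun e => huv (by rw [e])
    rcases lt_or_gt_of_ne hab with hlt | hlt
    · exact inter_of_forall hne fun p hp => h.inter_of_lt hlt hb hp.1 hp.2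
    · rw [Set.inter_comm] at hne
      rw [Set.inter_comm (Tile.vertices _ _), Set.inter_comm (Tile.edges _ _),
        Set.inter_comm (Tile.carrier _ _)]
      exact inter_of_forall hne fun p hp => h.inter_of_lt hlt ha hp.1 hp.2

end IsTileChain

theorem IsPeakPit.exists_isTilingType (hn : 2 ≤ n) (ξ : ZonogonVectors n) {D : Set (LinOrd n)}
    (hD : IsPeakPit D) : ∃ D' : Set (LinOrd n), IsTilingType ξ D' ∧ D ⊆ D' := by
  obtain ⟨D', hDD', hD', N, s, h0, hN, hs, hf⟩ := hD.exists_chain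
  have htile : ∀ m, ∃ t : Tile n, m < N → IsFlipTile ξ (s m) (s (m + 1)) t := by
    intro m
    by_cases hm : m < N
    · obtain ⟨i, j, hij⟩ := hf m hm
      exact ⟨⟨sumVec ξ (before (s m) i), i, j, hij.lt⟩, fun _ => ⟨hij, rfl⟩⟩
    -- An arbitrary tile for indices past the end of the chain.
    · exact ⟨⟨0, ⟨0, by omega⟩, ⟨1, by omega⟩, by simp [Fin.lt_def]⟩, fun h => absurd h hm⟩
  choose t ht using htile
  have hchain : IsTileChain ξ N s t := ⟨h0, hN, ht⟩
  refine ⟨_, ⟨_, hchain.isTiling hn, rfl⟩, fun τ hτ => ?_⟩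
  refine EdgesIn.mem_snakeOrders (by omega) (fun u hu => hchain.carrier_subset hu) fun c => ?_
  obtain ⟨m, hm, hmc⟩ := hD'.exists_before_eq h0 hN hs hf (hDD' hτ) c
  rw [← hmc]
  exact hchain.edgesIn hn hm c

end CondorcetTiling

theorem theorem4 (n : ℕ) (hn : 2 ≤ n) (ξ : CondorcetTiling.ZonogonVectors n) :
    (∀ D : Set (CondorcetTiling.LinOrd n),
      CondorcetTiling.IsTilingType ξ D → CondorcetTiling.IsSemiConnected D) ∧
    (∀ D : Set (CondorcetTiling.LinOrd n),
      CondorcetTiling.IsCondorcetDomain D → CondorcetTiling.IsSemiConnected D →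
        CondorcetTiling.IsPeakPit D) ∧
    (∀ D : Set (CondorcetTiling.LinOrd n),
      CondorcetTiling.IsPeakPit D →
        ∃ D' : Set (CondorcetTiling.LinOrd n),
          CondorcetTiling.IsTilingType ξ D' ∧ D ⊆ D') := by
  exact ⟨fun D h => h.isSemiConnected (by omega), fun D hC hS => hS.isPeakPit hC,
    fun D hD => hD.exists_isTilingType hn ξ⟩
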